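/- Let $\alpha\in(0,2)$ and let $\mu$ be a symmetric probability law on $\mathbb R$ that is regularly varying with index $\alpha$, i.e. $\mu(\{y:|y|\ge x\})\sim L(x)x^{-\alpha}$ as $x\to\infty$ for some function $L$ with $L(ax)/L(x)\to1$ as $x\to\infty$ for every $a>0$. For $p\ge1$ let $\mu_{\alpha,p}$ be the symmetric $\alpha$-spherical distribution generated by $\mu$, i.e. the law, assumed to be supported on the unit sphere $\mathbb S^{p-1}$, of $$\Big(\tfrac{X_1}{\sqrt{\sum_{k=1}^pX_k^2}},\dots,\tfrac{X_p}{\sqrt{\sum_{k=1}^pX_k^2}}\Big),$$ where $X_1,\dots,X_p$ are i.i.d. with law $\mu$. Let $p=p_n$ be positive integers with $p_n/n\to\gamma\in(0,\infty)$ as $n\to\infty$. For each $n$ let $\boldsymbol X_1,\dots,\boldsymbol X_n$ be independent with law $\mu_{\alpha,p_n}$ (the law $\mu$ does not depend on $n$), and let $$B_n=\frac pn\sum_{1\le i<j\le n}\Big[(\boldsymbol X_i^\top\boldsymbol X_j)^2-\frac1p\Big]$$ be the Bingham statistic. Then, as $n\to\infty$, $$\frac{\sqrt n}{p}\,B_n\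 \xrightarrow{d}\ N\Big(0,\frac{(2-\alpha)^2}{8\gamma}\Big).$$ Consequently, for every $\beta\in(0,1)$, if $q_\beta$ denotes the $(1-\beta)$-quantile of the standard normal distribution, then the Bingham test of nominal level $\beta$, which rejects when $B_n\ge q_\beta$, satisfies $\lim_{n\to\infty}\mathbb P(B_n\ge q_\beta)=\tfrac12$. -/

import Mathlib

open MeasureTheory ProbabilityTheory Filter Topology Asymptotics

noncomputable section

/-- `L` is slowly varying (at infinity): `L (a x) / L x → 1` as `x → ∞`, for every `a > 0`. -/
def SlowlyVarying (L : ℝ → ℝ) : Prop :=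
  ∀ a : ℝ, 0 < a → Tendsto (fun x => L (a * x) / L x) atTop (𝓝 1)

/-- The law `μ` on the line is regularly varying with index `α`:
`μ {y | |y| ≥ x} ∼ L(x) x^{-α}` as `x → ∞`, for some slowly varying `L`. -/
def RegularlyVarying (α : ℝ) (μ : Measure ℝ) : Prop :=
  ∃ L : ℝ → ℝ, SlowlyVarying L ∧
    (fun x : ℝ => μ.real {y : ℝ | x ≤ |y|}) ~[atTop] (fun x : ℝ => L x * x ^ (-α))

/-- The projection `x ↦ x / √(∑ₖ xₖ²)` of `ℝᵖ` onto the unit sphere. -/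
def sphereProj {p : ℕ} (x : Fin p → ℝ) : EuclideanSpace ℝ (Fin p) :=
  WithLp.toLp 2 (fun i => x i / √(∑ k, x k ^ 2))

/-- `ν` is the symmetric `α`-spherical distribution on the unit sphere of `ℝᵖ` generated by the
law `μ` on the line: `μ` is a symmetric probability law, regularly varying with index `α ∈ (0, 2)`,
`ν` is supported on the unit sphere, and `ν` is the law of the projection onto the sphere of a
vector with `p` independent coordinates of law `μ`. -/
structure IsSymmetricAlphaSpherical (α : ℝ) (μ : Measure ℝ) {p : ℕ}
    (ν : Measure (EuclideanSpace ℝ (Fin p))) : Prop where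
  index_pos : 0 < α
  index_lt_two : α < 2
  isProbabilityMeasure : IsProbabilityMeasure μ
  regularlyVarying : RegularlyVarying α μ
  symmetric : μ.map (fun y => -y) = μ
  supported : ∀ᵐ x ∂ν, x ∈ Metric.sphere (0 : EuclideanSpace ℝ (Fin p)) 1
  eq_map : ν = (Measure.pi (fun _ : Fin p => μ)).map sphereProj

/-- The Bingham statistic `(p / n) ∑_{i < j} ((xᵢᵀ xⱼ)² - 1 / p)` of the points
`x₁, …, xₙ` in `ℝᵖ`. -/
def binghamStat {n p : ℕ} (x : Fin n → EuclideanSpace ℝ (Fin p)) : ℝ :=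
  (p : ℝ) / n * ∑ i : Fin n, ∑ j ∈ Finset.Ioi i, ((inner ℝ (x i) (x j)) ^ 2 - 1 / (p : ℝ))

end

/-! After rescaling, the statistic is `n^(-1/2)` times the sum over pairs of the kernel `h(x, y) =
(xᵀy)² - 1/p`. Exchangeability and sign symmetry of the coordinates give `E (Zᵀx)² = ‖x‖²/p`, so `h`
is degenerate and the pair sum is a martingale in the number of sample points.

The central limit theorem is proved on characteristic functions, one point at a time
(`DegenerateKernel.norm_step_le`). Given the first `k` points, a new point adds a centred increment
whose conditional variance is close in `L¹` to `k s`, with `s = E h²`; hence the characteristic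
function is multiplied by about `exp (-θ² k s / 2)`. Telescoping gives `exp (-θ² n (n - 1) s / 4)`.
The errors vanish for `θ = t/√n` when the conditional second moments of `h` are `O(1/n)` and its
iterated kernel has squared norm `O(1/n³)`. Both bounds follow from the mixed fourth moments, which
symmetry reduces to `m₄ = E Z₁⁴` and `m₂₂ = E Z₁² Z₂²`.

There remains the variance: `p s` has the limit of `(p m₄)²`, so what is needed is `p m₄ = E ∑ Z_k⁴
→ 1 - α/2` (`RegularlyVarying.tendsto_integral_sum_sphereProj_pow_four`). Writing powers of `1 / ∑
X_k²` as Gamma integrals and using independence turns `E ∑ Z_k⁴` and `E ∑ Z_k² = 1` into integrals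
over `s` of `p E(s X⁴ e^{-sX²}) φ(s)^{p-1}` and `p E(X² e^{-sX²}) φ(s)^{p-1}`, with `φ(s) = E
e^{-sX²}`. The power of `φ` concentrates both at `s = 0`, where Karamata's theorem gives the ratio
`Γ(2 - α/2) / Γ(1 - α/2) = 1 - α/2`.

The statement on the test follows because the critical value, multiplied by `√n/p`, tends to `0`:
the rejection probability tends to the mass that a centred Gaussian gives to `[0, ∞)`. -/

/-! ### Bounded measurable functions, for which all integrability is automatic. -/

section BoundedMeasurable

variable {α β ι : Type*} [MeasurableSpace α] [MeasurableSpace β]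

/-- A bounded measurable real function. -/
def BoundedMeasurable (f : α → ℝ) : Prop := Measurable f ∧ ∃ C, ∀ x, |f x| ≤ C

namespace BoundedMeasurable

lemma const (c : ℝ) : BoundedMeasurable (fun _ : α => c) := ⟨measurable_const, |c|, fun _ => le_rfl⟩

lemma add {f g : α → ℝ} (hf : BoundedMeasurable f) (hg : BoundedMeasurable g) :
    BoundedMeasurable (fun x => f x + g x) := by
  obtain ⟨hf, C, hC⟩ := hf
  obtain ⟨hg, D, hD⟩ := hg
  exact ⟨hf.add hg, C + D, fun x => (abs_add_le _ _).trans (add_le_add (hC x) (hD x))⟩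

lemma mul {f g : α → ℝ} (hf : BoundedMeasurable f) (hg : BoundedMeasurable g) :
    BoundedMeasurable (fun x => f x * g x) := by
  obtain ⟨hf, C, hC⟩ := hf
  obtain ⟨hg, D, hD⟩ := hg
  refine ⟨hf.mul hg, C * D, fun x => ?_⟩
  rw [abs_mul]
  exact mul_le_mul (hC x) (hD x) (abs_nonneg _) ((abs_nonneg _).trans (hC x))

lemma neg {f : α → ℝ} (hf : BoundedMeasurable f) : BoundedMeasurable (fun x => -f x) := by
  simpa using (const (α := α) (-1)).mul hf

lemma sub {f g : α → ℝ} (hf : BoundedMeasurable f) (hg : BoundedMeasurable g) :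
    BoundedMeasurable (fun x => f x - g x) := by
  simpa [sub_eq_add_neg] using hf.add hg.neg

lemma pow {f : α → ℝ} (hf : BoundedMeasurable f) (n : ℕ) :
    BoundedMeasurable (fun x => f x ^ n) := by
  induction n with
  | zero => simpa using const (α := α) 1
  | succ n ih => simpa [pow_succ] using ih.mul hf

lemma abs {f : α → ℝ} (hf : BoundedMeasurable f) : BoundedMeasurable (fun x => |f x|) := by
  obtain ⟨hf, C, hC⟩ := hf
  exact ⟨hf.norm, C, fun x => by simpa using hC x⟩

lemma sum {s : Finset ι} {f : ι → α → ℝ} (hf : ∀ i ∈ s, BoundedMeasurable (f i)) :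
    BoundedMeasurable (fun x => ∑ i ∈ s, f i x) := by
  classical
  induction s using Finset.induction_on with
  | empty => simpa using const (α := α) 0
  | insert a s ha ih =>
    simp only [Finset.sum_insert ha]
    exact (hf a (by simp)).add (ih fun i hi => hf i (by simp [hi]))

lemma comp {f : α → ℝ} (hf : BoundedMeasurable f) {g : β → α} (hg : Measurable g) :
    BoundedMeasurable (fun x => f (g x)) :=
  ⟨hf.1.comp hg, hf.2.imp fun _ hC _ => hC _⟩

lemma integrable {f : α → ℝ} (hf : BoundedMeasurable f) (μ : Measure α) [IsFiniteMeasure μ] :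
    Integrable f μ := by
  obtain ⟨hf, C, hC⟩ := hf
  exact Integrable.of_bound hf.aestronglyMeasurable C (ae_of_all _ hC)

lemma integral_right {f : α → β → ℝ} (hf : BoundedMeasurable (Function.uncurry f))
    (ν : Measure β) [IsProbabilityMeasure ν] : BoundedMeasurable (fun a => ∫ b, f a b ∂ν) := by
  obtain ⟨hf, C, hC⟩ := hf
  refine ⟨(hf.stronglyMeasurable.integral_prod_right (ν := ν)).measurable, C, fun a => ?_⟩
  have := norm_integral_le_of_norm_le_const (μ := ν) (f := f a) (C := C)
    (ae_of_all _ fun b => hC (a, b))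
  simpa using this

lemma integral_left {f : β → α → ℝ} (hf : BoundedMeasurable (Function.uncurry f))
    (ν : Measure β) [IsProbabilityMeasure ν] : BoundedMeasurable (fun a => ∫ b, f b a ∂ν) :=
  integral_right (f := fun a b => f b a) (hf.comp measurable_swap) ν

end BoundedMeasurable

end BoundedMeasurable

/-! ### Splitting one coordinate off a product measure. -/

section PiSucc

variable {E : Type*} [MeasurableSpace E] (ν : Measure E) [IsProbabilityMeasure ν]

lemma measurable_finCons {k : ℕ} :
    Measurable (fun q : E × (Fin k → E) => (Fin.cons q.1 q.2 : Fin (k + 1) → E)) := by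
  refine measurable_pi_iff.2 fun i => ?_
  refine Fin.cases ?_ (fun j => ?_) i
  · simpa using measurable_fst
  · simp only [Fin.cons_succ]
    fun_prop

lemma integral_pi_succ_prod {F : Type*} [NormedAddCommGroup F] [NormedSpace ℝ F] {k : ℕ}
    (g : (Fin (k + 1) → E) → F) :
    ∫ x, g x ∂(Measure.pi fun _ : Fin (k + 1) => ν)
      = ∫ q : E × (Fin k → E), g (Fin.cons q.1 q.2) ∂(ν.prod (Measure.pi fun _ : Fin k => ν)) := by
  rw [← ((measurePreserving_piFinSuccAbove (fun _ : Fin (k + 1) => ν) 0).symm).integral_comp']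
  simp [MeasurableEquiv.piFinSuccAbove_symm_apply, Fin.insertNthEquiv]

lemma integral_pi_succ {F : Type*} [NormedAddCommGroup F] [NormedSpace ℝ F] {k : ℕ}
    (g : (Fin (k + 1) → E) → F) (hg : StronglyMeasurable g) (C : ℝ) (hC : ∀ x, ‖g x‖ ≤ C) :
    ∫ x, g x ∂(Measure.pi fun _ : Fin (k + 1) => ν)
      = ∫ x, ∫ z, g (Fin.cons z x) ∂ν ∂(Measure.pi fun _ : Fin k => ν) := by
  rw [integral_pi_succ_prod, integral_prod_symm]
  exact Integrable.of_bound (hg.comp_measurable measurable_finCons).aestronglyMeasurable C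
    (ae_of_all _ fun q => hC _)

end PiSucc

/-! ### Moments of sums and pair sums of i.i.d. variables. -/

section PairSum

variable {E : Type*} [MeasurableSpace E] (ν : Measure E) [IsProbabilityMeasure ν]

/-- The sum of a kernel over the pairs of distinct entries of a finite sequence. -/
def pairSum {E : Type*} (K : E → E → ℝ) {k : ℕ} (x : Fin k → E) : ℝ :=
  ∑ i : Fin k, ∑ j ∈ Finset.Ioi i, K (x i) (x j)

lemma pairSum_cons {E : Type*} (K : E → E → ℝ) {k : ℕ} (z : E) (x : Fin k → E) :
    pairSum K (Fin.cons z x : Fin (k + 1) → E) = ∑ i, K z (x i) + pairSum K x := by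
  simp [pairSum, Fin.sum_univ_succ, Fin.sum_Ioi_succ]

lemma sq_sum_fin {k : ℕ} (a : Fin k → ℝ) :
    (∑ i, a i) ^ 2 = ∑ i, a i ^ 2 + 2 * ∑ i : Fin k, ∑ j ∈ Finset.Ioi i, a i * a j := by
  induction k with
  | zero => simp
  | succ k ih =>
    have := ih (fun i => a i.succ)
    simp only [Fin.sum_univ_succ, Fin.sum_Ioi_succ, Fin.sum_Ioi_zero, ← Finset.mul_sum] at this ⊢
    linear_combination this

lemma BoundedMeasurable.pairSum {K : E → E → ℝ} (hK : BoundedMeasurable (Function.uncurry K))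
    (k : ℕ) : BoundedMeasurable (fun x : Fin k → E => pairSum K x) :=
  .sum fun i _ => .sum fun j _ =>
    hK.comp (g := fun x : Fin k → E => (x i, x j)) (by fun_prop)

lemma BoundedMeasurable.sum_apply {u : E → ℝ} (hu : BoundedMeasurable u) (k : ℕ) :
    BoundedMeasurable (fun x : Fin k → E => ∑ i, u (x i)) :=
  .sum fun i _ => hu.comp (measurable_pi_apply i)

lemma BoundedMeasurable.integral_pi_succ {k : ℕ} {g : (Fin (k + 1) → E) → ℝ}
    (hg : BoundedMeasurable g) :
    ∫ x, g x ∂(Measure.pi fun _ : Fin (k + 1) => ν)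
      = ∫ x, ∫ z, g (Fin.cons z x) ∂ν ∂(Measure.pi fun _ : Fin k => ν) := by
  obtain ⟨hg, C, hC⟩ := hg
  exact _root_.integral_pi_succ ν g hg.stronglyMeasurable C hC

lemma integral_sum_pi {u : E → ℝ} (hu : BoundedMeasurable u) (k : ℕ) :
    ∫ x, ∑ i, u (x i) ∂(Measure.pi fun _ : Fin k => ν) = k * ∫ x, u x ∂ν := by
  rw [integral_finsetSum _ fun i _ => (hu.comp (measurable_pi_apply i)).integrable _]
  simp [integral_comp_eval (μ := fun _ : Fin k => ν) hu.1.aestronglyMeasurable]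

lemma integral_sum_sq_pi {u : E → ℝ} (hu : BoundedMeasurable u) (h0 : ∫ x, u x ∂ν = 0) (k : ℕ) :
    ∫ x, (∑ i, u (x i)) ^ 2 ∂(Measure.pi fun _ : Fin k => ν) = k * ∫ x, u x ^ 2 ∂ν := by
  induction k with
  | zero => simp
  | succ k ih =>
    rw [((hu.sum_apply (k + 1)).pow 2).integral_pi_succ ν]
    have key : ∀ s : ℝ, ∫ z, (u z + s) ^ 2 ∂ν = ∫ z, u z ^ 2 ∂ν + s ^ 2 := fun s => by
      have e : ∀ z, (u z + s) ^ 2 = u z ^ 2 + 2 * s * u z + s ^ 2 := fun z => by ring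
      simp_rw [e]
      rw [integral_add (((hu.pow 2).add ((BoundedMeasurable.const _).mul hu)).integrable _)
        (integrable_const _), integral_add ((hu.pow 2).integrable _)
        (((BoundedMeasurable.const _).mul hu).integrable _), integral_const_mul, h0]
      simp
    simp only [Fin.sum_univ_succ, Fin.cons_zero, Fin.cons_succ, key]
    rw [integral_add (integrable_const _) (((hu.sum_apply k).pow 2).integrable _), ih]
    simp
    ring

/-- Adding one variable at a time, the terms odd in it or in the old sum cancel by centring, except
the pure fourth powers; the recursion then needs only `3k² + 6k ≤ 3(k+1)²`. -/
lemma integral_sum_pow_four_pi_le {u : E → ℝ} (hu : BoundedMeasurable u) (h0 : ∫ x, u x ∂ν = 0)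
    (k : ℕ) :
    ∫ x, (∑ i, u (x i)) ^ 4 ∂(Measure.pi fun _ : Fin k => ν)
      ≤ k * ∫ x, u x ^ 4 ∂ν + 3 * k ^ 2 * (∫ x, u x ^ 2 ∂ν) ^ 2 := by
  induction k with
  | zero => simp
  | succ k ih =>
    rw [((hu.sum_apply (k + 1)).pow 4).integral_pi_succ ν]
    have key : ∀ s : ℝ, ∫ z, (u z + s) ^ 4 ∂ν = ∫ z, u z ^ 4 ∂ν + 4 * (∫ z, u z ^ 3 ∂ν) * s
        + 6 * (∫ z, u z ^ 2 ∂ν) * s ^ 2 + s ^ 4 := fun s => by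
      have e : ∀ z, (u z + s) ^ 4 = u z ^ 4 + (4 * s) * u z ^ 3 + (6 * s ^ 2) * u z ^ 2
          + 4 * s ^ 3 * u z + s ^ 4 := fun z => by ring
      simp_rw [e]
      have c := fun c : ℝ => BoundedMeasurable.const (α := E) c
      have h4 := hu.pow 4
      have h3 := (c (4 * s)).mul (hu.pow 3)
      have h2 := (c (6 * s ^ 2)).mul (hu.pow 2)
      have h1 := (c (4 * s ^ 3)).mul hu
      rw [integral_add ((((h4.add h3).add h2).add h1).integrable _) (integrable_const _),
        integral_add (((h4.add h3).add h2).integrable _) (h1.integrable _),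
        integral_add ((h4.add h3).integrable _) (h2.integrable _),
        integral_add (h4.integrable _) (h3.integrable _)]
      simp only [integral_const_mul, h0, integral_const, probReal_univ, smul_eq_mul]
      ring
    have hs := hu.sum_apply k
    have c := fun c : ℝ => BoundedMeasurable.const (α := Fin k → E) c
    simp only [Fin.sum_univ_succ, Fin.cons_zero, Fin.cons_succ, key]
    rw [integral_add ((((c _).add ((c _).mul hs)).add ((c _).mul (hs.pow 2))).integrable _)
        ((hs.pow 4).integrable _),
      integral_add (((c _).add ((c _).mul hs)).integrable _) (((c _).mul (hs.pow 2)).integrable _),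
      integral_add ((c _).integrable _) (((c _).mul hs).integrable _)]
    simp only [integral_const_mul, integral_const, probReal_univ, smul_eq_mul,
      integral_sum_sq_pi ν hu h0, integral_sum_pi ν hu, h0]
    push_cast
    nlinarith [ih, sq_nonneg (∫ x, u x ^ 2 ∂ν)]

/-- Degeneracy makes the row contributed by a new point orthogonal to the old pair sum, and that row
has second moment `k ∬ K²`. The factor `k²` is a crude bound for the number of pairs. -/
lemma integral_pairSum_sq_le {K : E → E → ℝ} (hK : BoundedMeasurable (Function.uncurry K))
    (h1 : ∀ x, ∫ z, K z x ∂ν = 0) (h2 : ∀ z, ∫ x, K z x ∂ν = 0) (k : ℕ) :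
    ∫ x, pairSum K x ^ 2 ∂(Measure.pi fun _ : Fin k => ν)
      ≤ k ^ 2 * ∫ z, ∫ x, K z x ^ 2 ∂ν ∂ν := by
  have hn : 0 ≤ ∫ z, ∫ x, K z x ^ 2 ∂ν ∂ν :=
    integral_nonneg fun z => integral_nonneg fun x => sq_nonneg _
  induction k with
  | zero => simp [pairSum]
  | succ k ih =>
    rw [((hK.pairSum (k + 1)).pow 2).integral_pi_succ ν]
    have hT := hK.pairSum k
    have hY : BoundedMeasurable (Function.uncurry fun (z : E) (x : Fin k → E) => ∑ i, K z (x i)) :=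
      .sum fun i _ => hK.comp (g := fun q : E × (Fin k → E) => (q.1, q.2 i)) (by fun_prop)
    have key : ∀ x : Fin k → E, ∫ z, (∑ i, K z (x i) + pairSum K x) ^ 2 ∂ν
        = ∫ z, (∑ i, K z (x i)) ^ 2 ∂ν + pairSum K x ^ 2 := fun x => by
      have e : ∀ z, (∑ i, K z (x i) + pairSum K x) ^ 2 = (∑ i, K z (x i)) ^ 2
          + 2 * pairSum K x * (∑ i, K z (x i)) + pairSum K x ^ 2 := fun z => by ring
      simp_rw [e]
      have hYx : BoundedMeasurable (fun z => ∑ i, K z (x i)) :=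
        hY.comp (g := fun z => (z, x)) (by fun_prop)
      have h0 : ∫ z, ∑ i, K z (x i) ∂ν = 0 := by
        rw [integral_finsetSum (f := fun i z => K z (x i)) _ fun i _ =>
          (hK.comp (g := fun z => (z, x i)) (by fun_prop)).integrable _]
        simp [h1]
      rw [integral_add (((hYx.pow 2).add ((BoundedMeasurable.const _).mul hYx)).integrable _)
        (integrable_const _), integral_add ((hYx.pow 2).integrable _)
        (((BoundedMeasurable.const _).mul hYx).integrable _), integral_const_mul, h0]
      simp
    simp only [pairSum_cons, key]
    rw [integral_add ((BoundedMeasurable.integral_left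
      (f := fun z (x : Fin k → E) => (∑ i, K z (x i)) ^ 2) (hY.pow 2) ν).integrable _)
      ((hT.pow 2).integrable _), integral_integral_swap ?_]
    · have : ∀ z, ∫ x, (∑ i, K z (x i)) ^ 2 ∂(Measure.pi fun _ : Fin k => ν)
          = k * ∫ x, K z x ^ 2 ∂ν := fun z =>
        integral_sum_sq_pi ν (hK.comp (g := fun x => (z, x)) (by fun_prop)) (h2 z) k
      simp only [this, integral_const_mul]
      push_cast
      nlinarith
    · exact ((hY.pow 2).comp measurable_swap).integrable _

end PairSum

/-! ### Taylor bounds for the exponential. -/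

/-- The constant comes from `|a| ≥ 1`, where the terms are bounded separately by `2 + |a| + |a|²/2`;
for `|a| ≤ 1` the Taylor remainder is smaller. -/
lemma norm_cexp_ofReal_mul_I_sub_le (a : ℝ) :
    ‖Complex.exp (a * Complex.I) - (1 + a * Complex.I - a ^ 2 / 2)‖ ≤ 4 * |a| ^ 3 := by
  have hn : ‖(a : ℂ) * Complex.I‖ = |a| := by simp
  rcases le_total |a| 1 with ha | ha
  · have := Complex.exp_bound (x := a * Complex.I) (hn ▸ ha) (n := 3) (by norm_num)
    rw [hn] at this
    have e : ∑ m ∈ Finset.range 3, (a * Complex.I) ^ m / (m.factorial : ℂ)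
        = 1 + a * Complex.I - a ^ 2 / 2 := by
      simp [Finset.sum_range_succ, mul_pow, Nat.factorial]
      ring
    rw [e] at this
    refine this.trans ?_
    rw [mul_comm]
    refine mul_le_mul_of_nonneg_right ?_ (by positivity)
    norm_num [Nat.factorial]
  · have h1 : ‖Complex.exp (a * Complex.I) - (1 + a * Complex.I - a ^ 2 / 2)‖
        ≤ 1 + (1 + |a| + |a| ^ 2 / 2) := by
      refine (norm_sub_le _ _).trans (add_le_add (by rw [Complex.norm_exp_ofReal_mul_I]) ?_)
      refine (norm_sub_le _ _).trans (add_le_add ((norm_add_le _ _).trans ?_) ?_)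
      · simp
      · simp
    refine h1.trans ?_
    have h2 : |a| ≤ |a| ^ 2 := by nlinarith
    have h3 : |a| ^ 2 ≤ |a| ^ 3 := by nlinarith [sq_nonneg |a|]
    linarith

lemma abs_exp_neg_sub_le {x : ℝ} (hx : 0 ≤ x) : |Real.exp (-x) - (1 - x)| ≤ x ^ 2 := by
  rcases le_total x 1 with h | h
  · have := Real.abs_exp_sub_one_sub_id_le (x := -x) (by rwa [abs_neg, abs_of_nonneg hx])
    rw [neg_sq] at this
    convert this using 2
    ring
  · rw [abs_le]
    have h1 := Real.exp_pos (-x)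
    have h2 : Real.exp (-x) ≤ 1 := Real.exp_le_one_iff.2 (by linarith)
    constructor <;> nlinarith

/-! ### Gaussian approximation for degenerate U-statistics. -/

section DegenerateUStatistic

variable {E : Type*} [MeasurableSpace E] {ν : Measure E} [IsProbabilityMeasure ν]

/-- The cubic Taylor remainder is split by `2|u|³ ≤ u² + u⁴`, so that only even moments, which can
be computed exactly or by recursion, appear. -/
lemma norm_integral_cexp_sub_le {u : E → ℝ} (hu : BoundedMeasurable u) (h0 : ∫ x, u x ∂ν = 0)
    (θ : ℝ) :
    ‖∫ x, Complex.exp ((θ * u x : ℝ) * Complex.I) ∂ν - (1 - θ ^ 2 / 2 * ∫ x, u x ^ 2 ∂ν : ℝ)‖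
      ≤ 2 * |θ| ^ 3 * (∫ x, u x ^ 2 ∂ν + ∫ x, u x ^ 4 ∂ν) := by
  have c := fun c : ℝ => BoundedMeasurable.const (α := E) c
  have hmeas : Measurable fun x => Complex.exp ((θ * u x : ℝ) * Complex.I) := by
    have := hu.1
    fun_prop
  have hint : Integrable (fun x => Complex.exp ((θ * u x : ℝ) * Complex.I)) ν :=
    Integrable.of_bound hmeas.aestronglyMeasurable 1
      (ae_of_all _ fun x => (Complex.norm_exp_ofReal_mul_I _).le)
  have hI : Integrable (fun x => ((θ * u x : ℝ) : ℂ) * Complex.I) ν :=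
    (((c θ).mul hu).integrable ν).ofReal.mul_const _
  have hR : Integrable (fun x => ((1 - θ ^ 2 / 2 * u x ^ 2 : ℝ) : ℂ)) ν :=
    (((c 1).sub ((c _).mul (hu.pow 2))).integrable ν).ofReal
  have e : ∫ x, Complex.exp ((θ * u x : ℝ) * Complex.I) ∂ν
      - (1 - θ ^ 2 / 2 * ∫ x, u x ^ 2 ∂ν : ℝ)
      = ∫ x, (Complex.exp ((θ * u x : ℝ) * Complex.I) - (((θ * u x : ℝ) : ℂ) * Complex.I
        + ((1 - θ ^ 2 / 2 * u x ^ 2 : ℝ) : ℂ))) ∂ν := by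
    rw [integral_sub (g := fun x => ((θ * u x : ℝ) : ℂ) * Complex.I
      + ((1 - θ ^ 2 / 2 * u x ^ 2 : ℝ) : ℂ)) hint (hI.add hR), integral_add hI hR, integral_mul_const,
      integral_complex_ofReal, integral_complex_ofReal, integral_const_mul, h0, integral_sub (integrable_const _)
      (((c _).mul (hu.pow 2)).integrable ν), integral_const_mul]
    simp
  rw [e]
  have hb : 2 * |θ| ^ 3 * (∫ x, u x ^ 2 ∂ν + ∫ x, u x ^ 4 ∂ν)
      = ∫ x, 2 * |θ| ^ 3 * (u x ^ 2 + u x ^ 4) ∂ν := by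
    rw [integral_const_mul, integral_add ((hu.pow 2).integrable ν) ((hu.pow 4).integrable ν)]
  rw [hb]
  refine norm_integral_le_of_norm_le
    (((c _).mul ((hu.pow 2).add (hu.pow 4))).integrable ν) (ae_of_all _ fun x => ?_)
  have h := norm_cexp_ofReal_mul_I_sub_le (θ * u x)
  have e2 : ((θ * u x : ℝ) : ℂ) * Complex.I + ((1 - θ ^ 2 / 2 * u x ^ 2 : ℝ) : ℂ)
      = 1 + ((θ * u x : ℝ) : ℂ) * Complex.I - ((θ * u x : ℝ) : ℂ) ^ 2 / 2 := by
    push_cast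
    ring
  rw [e2]
  refine h.trans ?_
  rw [abs_mul, mul_pow]
  have h4 : u x ^ 4 = |u x| ^ 4 := by rw [← abs_pow, abs_of_nonneg (by positivity)]
  rw [h4, ← sq_abs (u x)]
  have h3 : 2 * |u x| ^ 3 ≤ |u x| ^ 2 + |u x| ^ 4 := by
    nlinarith [mul_nonneg (sq_nonneg |u x|) (sq_nonneg (|u x| - 1))]
  have : 0 ≤ |θ| ^ 3 := by positivity
  nlinarith

lemma integral_abs_le_sqrt {u : E → ℝ} (hu : BoundedMeasurable u) :
    ∫ x, |u x| ∂ν ≤ √(∫ x, u x ^ 2 ∂ν) := by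
  refine Real.le_sqrt_of_sq_le ?_
  set m := ∫ x, |u x| ∂ν with hm
  have h : 0 ≤ ∫ x, (|u x| - m) ^ 2 ∂ν := integral_nonneg fun x => sq_nonneg _
  have e : ∀ x, (|u x| - m) ^ 2 = u x ^ 2 - 2 * m * |u x| + m ^ 2 := fun x => by
    rw [← sq_abs (u x)]
    ring
  simp_rw [e] at h
  have c := fun c : ℝ => BoundedMeasurable.const (α := E) c
  rw [integral_add (((hu.pow 2).sub ((c _).mul hu.abs)).integrable ν) (integrable_const _),
    integral_sub ((hu.pow 2).integrable ν) (((c _).mul hu.abs).integrable ν),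
    integral_const_mul, ← hm] at h
  simp at h
  nlinarith

/-- A symmetric kernel bounded by `1`, degenerate with respect to `ν`, with conditional second
moments at most `a` and with the Hilbert–Schmidt norm of its iterate at most `b`. -/
structure DegenerateKernel (ν : Measure E) (h : E → E → ℝ) (a b : ℝ) : Prop where
  measurable : Measurable (Function.uncurry h)
  abs_le_one : ∀ x y, |h x y| ≤ 1
  symm : ∀ x y, h x y = h y x
  integral_eq_zero : ∀ x, ∫ z, h z x ∂ν = 0
  integral_sq_le : ∀ x, ∫ z, h z x ^ 2 ∂ν ≤ a
  integral_iterate_sq_le : ∫ x, ∫ y, (∫ z, h z x * h z y ∂ν) ^ 2 ∂ν ∂ν ≤ b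

namespace DegenerateKernel

variable {h : E → E → ℝ} {a b : ℝ} (H : DegenerateKernel ν h a b)
include H

omit [IsProbabilityMeasure ν] in
lemma boundedMeasurable : BoundedMeasurable (Function.uncurry h) :=
  ⟨H.measurable, 1, fun q => H.abs_le_one q.1 q.2⟩

omit [IsProbabilityMeasure ν] in
lemma left (x : E) : BoundedMeasurable (fun z => h z x) :=
  H.boundedMeasurable.comp (g := fun z => (z, x)) (by fun_prop)

omit [IsProbabilityMeasure ν] in
lemma right (x : E) : BoundedMeasurable (fun z => h x z) :=
  H.boundedMeasurable.comp (g := fun z => (x, z)) (by fun_prop)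

omit [IsProbabilityMeasure ν] in
lemma integral_right_eq_zero (x : E) : ∫ z, h x z ∂ν = 0 := by
  simp_rw [H.symm x, H.integral_eq_zero]

omit [IsProbabilityMeasure ν] in
lemma integral_right_sq_le (x : E) : ∫ z, h x z ^ 2 ∂ν ≤ a := by
  simp_rw [H.symm x]
  exact H.integral_sq_le x

omit [IsProbabilityMeasure ν] in
lemma sum_boundedMeasurable (k : ℕ) :
    BoundedMeasurable (Function.uncurry fun (z : E) (x : Fin k → E) => ∑ i, h z (x i)) :=
  .sum fun i _ => H.boundedMeasurable.comp (g := fun q : E × (Fin k → E) => (q.1, q.2 i))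
    (by fun_prop)

lemma iterate_boundedMeasurable :
    BoundedMeasurable (Function.uncurry fun x y => ∫ z, h z x * h z y ∂ν) := by
  refine BoundedMeasurable.integral_right (f := fun (q : E × E) z => h z q.1 * h z q.2) ?_ ν
  exact (H.boundedMeasurable.comp (g := fun q : (E × E) × E => (q.2, q.1.1)) (by fun_prop)).mul
    (H.boundedMeasurable.comp (g := fun q : (E × E) × E => (q.2, q.1.2)) (by fun_prop))

lemma integral_iterate_eq_zero (x : E) : ∫ y, ∫ z, h z x * h z y ∂ν ∂ν = 0 := by
  rw [integral_integral_swap]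
  · simp_rw [integral_const_mul, H.integral_right_eq_zero]
    simp
  · exact BoundedMeasurable.integrable ((H.boundedMeasurable.comp
      (g := fun q : E × E => (q.2, x)) (by fun_prop)).mul
      (H.boundedMeasurable.comp (g := fun q : E × E => (q.2, q.1)) (by fun_prop))) _

/-- The conditional variance of the next increment splits into an i.i.d. sum and a pair sum of the
iterated kernel, which is again degenerate; both parts fluctuate little. -/
lemma integral_sum_sq_eq {k : ℕ} (x : Fin k → E) :
    ∫ z, (∑ i, h z (x i)) ^ 2 ∂ν
      = ∑ i, ∫ z, h z (x i) ^ 2 ∂ν + 2 * pairSum (fun x y => ∫ z, h z x * h z y ∂ν) x := by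
  have i1 : ∀ i, Integrable (fun z => h z (x i) ^ 2) ν := fun i => ((H.left _).pow 2).integrable ν
  have i2 : ∀ i j, Integrable (fun z => h z (x i) * h z (x j)) ν := fun i j =>
    ((H.left _).mul (H.left _)).integrable ν
  simp_rw [sq_sum_fin]
  rw [integral_add (integrable_finsetSum _ fun i _ => i1 i)
    ((integrable_finsetSum _ fun i _ => integrable_finsetSum _ fun j _ => i2 i j).const_mul _),
    integral_const_mul, integral_finsetSum _ fun i _ => i1 i,
    integral_finsetSum _ fun i _ => integrable_finsetSum _ fun j _ => i2 i j]
  simp_rw [integral_finsetSum _ fun j _ => i2 _ j]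
  rfl

lemma integral_condVar_eq (k : ℕ) :
    ∫ x, ∫ z, (∑ i, h z (x i)) ^ 2 ∂ν ∂(Measure.pi fun _ : Fin k => ν)
      = k * ∫ z, ∫ x, h z x ^ 2 ∂ν ∂ν := by
  rw [integral_integral_swap]
  · simp_rw [integral_sum_sq_pi ν (H.right _) (H.integral_right_eq_zero _), integral_const_mul]
  · exact (((H.sum_boundedMeasurable k).pow 2).comp measurable_swap).integrable _

omit [IsProbabilityMeasure ν] H in
lemma integral_sq_nonneg : 0 ≤ ∫ z, ∫ x, h z x ^ 2 ∂ν ∂ν :=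
  integral_nonneg fun _ => integral_nonneg fun _ => sq_nonneg _

lemma integral_sq_le_bound : ∫ z, ∫ x, h z x ^ 2 ∂ν ∂ν ≤ a := by
  have := integral_mono (μ := ν) ((BoundedMeasurable.integral_right (f := fun z x => h z x ^ 2)
    (H.boundedMeasurable.pow 2) ν).integrable ν) (integrable_const a) H.integral_right_sq_le
  simpa using this

lemma bound_nonneg : 0 ≤ a := integral_sq_nonneg.trans H.integral_sq_le_bound

/-- With the integrals exchanged, the new point is fixed and the old ones are i.i.d., so the fourth
moment bound for sums applies; `h⁴ ≤ h²` because `|h| ≤ 1`. -/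
lemma integral_condFourth_le (k : ℕ) :
    ∫ x, ∫ z, (∑ i, h z (x i)) ^ 4 ∂ν ∂(Measure.pi fun _ : Fin k => ν)
      ≤ k * a + 3 * k ^ 2 * a ^ 2 := by
  rw [integral_integral_swap]
  · have hz : ∀ z, ∫ x, (∑ i, h z (x i)) ^ 4 ∂(Measure.pi fun _ : Fin k => ν)
        ≤ k * a + 3 * k ^ 2 * a ^ 2 := fun z => by
      refine (integral_sum_pow_four_pi_le ν (H.right z) (H.integral_right_eq_zero z) k).trans ?_
      have h1 := H.integral_right_sq_le z
      have h0 : 0 ≤ ∫ x, h z x ^ 2 ∂ν := integral_nonneg fun _ => sq_nonneg _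
      have h2 : ∫ x, h z x ^ 4 ∂ν ≤ ∫ x, h z x ^ 2 ∂ν := by
        refine integral_mono (((H.right z).pow 4).integrable ν) (((H.right z).pow 2).integrable ν)
          fun x => ?_
        have h3 : h z x ^ 2 ≤ 1 := (sq_le_one_iff_abs_le_one _).2 (H.abs_le_one z x)
        show h z x ^ 4 ≤ h z x ^ 2
        nlinarith [sq_nonneg (h z x)]
      gcongr
      exact h2.trans h1
    have := integral_mono (μ := ν) ((BoundedMeasurable.integral_right
      (f := fun z (x : Fin k → E) => (∑ i, h z (x i)) ^ 4)
      ((H.sum_boundedMeasurable k).pow 4) (Measure.pi fun _ : Fin k => ν)).integrable ν)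
      (integrable_const _) hz
    simpa using this
  · exact (((H.sum_boundedMeasurable k).pow 4).comp measurable_swap).integrable _

/-- Law of large numbers for the conditional variance: Cauchy–Schwarz reduces to a second moment,
and `(A + 2T)² ≤ 2A² + 8T²` separates the i.i.d. sum `A` from the pair sum `T` of the iterated
kernel. -/
lemma integral_abs_condVar_sub_le (k : ℕ) :
    ∫ x, |∫ z, (∑ i, h z (x i)) ^ 2 ∂ν - k * ∫ z, ∫ x, h z x ^ 2 ∂ν ∂ν|
      ∂(Measure.pi fun _ : Fin k => ν) ≤ √(2 * k * a ^ 2 + 8 * k ^ 2 * b) := by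
  set s := ∫ z, ∫ x, h z x ^ 2 ∂ν ∂ν with hs
  set f : E → ℝ := fun x => ∫ z, h z x ^ 2 ∂ν with hf
  set G : E → E → ℝ := fun x y => ∫ z, h z x * h z y ∂ν with hG
  have hfb : BoundedMeasurable f :=
    BoundedMeasurable.integral_left (f := fun z x => h z x ^ 2) (H.boundedMeasurable.pow 2) ν
  have hfs : ∫ x, f x ∂ν = s :=
    integral_integral_swap (((H.boundedMeasurable.pow 2).comp measurable_swap).integrable _)
  have hub : BoundedMeasurable (fun x => f x - s) := hfb.sub (.const _)
  have hu0 : ∫ x, (f x - s) ∂ν = 0 := by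
    rw [integral_sub (hfb.integrable ν) (integrable_const _), hfs]
    simp
  have hu2 : ∫ x, (f x - s) ^ 2 ∂ν ≤ a ^ 2 := by
    have := integral_mono (μ := ν) ((hub.pow 2).integrable ν) (integrable_const (a ^ 2)) fun x => by
      have h0 : 0 ≤ f x := integral_nonneg fun _ => sq_nonneg _
      have h1 : f x ≤ a := H.integral_sq_le x
      have h2 : 0 ≤ s := integral_sq_nonneg
      have h3 := H.integral_sq_le_bound
      show (f x - s) ^ 2 ≤ a ^ 2
      rw [sq_le_sq, abs_of_nonneg H.bound_nonneg, abs_le]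
      constructor <;> linarith
    simpa using this
  have hGb : BoundedMeasurable (Function.uncurry G) := H.iterate_boundedMeasurable
  have hv : ∀ x : Fin k → E, ∫ z, (∑ i, h z (x i)) ^ 2 ∂ν - k * s
      = ∑ i, (f (x i) - s) + 2 * pairSum G x := fun x => by
    rw [H.integral_sum_sq_eq, Finset.sum_sub_distrib]
    simp
    ring
  simp_rw [hv]
  have hAb := hub.sum_apply k
  have hTb := hGb.pairSum k
  refine (integral_abs_le_sqrt (hAb.add ((BoundedMeasurable.const 2).mul hTb))).trans
    (Real.sqrt_le_sqrt ?_)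
  have hA : ∫ x, (∑ i, (f (x i) - s)) ^ 2 ∂(Measure.pi fun _ : Fin k => ν) ≤ k * a ^ 2 := by
    rw [integral_sum_sq_pi ν hub hu0]
    gcongr
  have hT : ∫ x, pairSum G x ^ 2 ∂(Measure.pi fun _ : Fin k => ν) ≤ k ^ 2 * b := by
    refine (integral_pairSum_sq_le ν hGb (fun x => ?_) H.integral_iterate_eq_zero k).trans ?_
    · simp_rw [hG, mul_comm (h _ _) (h _ x)]
      exact H.integral_iterate_eq_zero x
    · exact mul_le_mul_of_nonneg_left H.integral_iterate_sq_le (by positivity)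
  calc ∫ x, (∑ i, (f (x i) - s) + 2 * pairSum G x) ^ 2 ∂(Measure.pi fun _ : Fin k => ν)
      ≤ ∫ x, (2 * (∑ i, (f (x i) - s)) ^ 2 + 8 * pairSum G x ^ 2)
          ∂(Measure.pi fun _ : Fin k => ν) := by
        refine integral_mono (((hAb.add ((BoundedMeasurable.const 2).mul hTb)).pow 2).integrable _)
          ((((BoundedMeasurable.const 2).mul (hAb.pow 2)).add
          ((BoundedMeasurable.const 8).mul (hTb.pow 2))).integrable _) fun x => ?_
        show (∑ i, (f (x i) - s) + 2 * pairSum G x) ^ 2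
          ≤ 2 * (∑ i, (f (x i) - s)) ^ 2 + 8 * pairSum G x ^ 2
        nlinarith [sq_nonneg (∑ i, (f (x i) - s) - 2 * pairSum G x)]
    _ ≤ 2 * k * a ^ 2 + 8 * k ^ 2 * b := by
        rw [integral_add (((BoundedMeasurable.const 2).mul (hAb.pow 2)).integrable _)
          (((BoundedMeasurable.const 8).mul (hTb.pow 2)).integrable _), integral_const_mul,
          integral_const_mul]
        linarith

/-- The three error terms are: the Taylor remainder of the conditional characteristic function of
the new increment, the deviation of its conditional variance from `k s`, and the replacement of `1 -
x` by `exp (-x)`. The old pair sum enters only through a factor of modulus `1`. -/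
lemma norm_step_le (θ : ℝ) (k : ℕ) :
    ‖∫ x, Complex.exp ((θ * pairSum h x : ℝ) * Complex.I) ∂(Measure.pi fun _ : Fin (k + 1) => ν)
      - (Real.exp (-(θ ^ 2 / 2 * (k * ∫ z, ∫ x, h z x ^ 2 ∂ν ∂ν))) : ℝ) *
        ∫ x, Complex.exp ((θ * pairSum h x : ℝ) * Complex.I) ∂(Measure.pi fun _ : Fin k => ν)‖
      ≤ 2 * |θ| ^ 3 * (2 * k * a + 3 * k ^ 2 * a ^ 2)
        + θ ^ 2 / 2 * √(2 * k * a ^ 2 + 8 * k ^ 2 * b) + (θ ^ 2 / 2 * (k * a)) ^ 2 := by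
  set s := ∫ z, ∫ x, h z x ^ 2 ∂ν ∂ν with hs
  set π := Measure.pi fun _ : Fin k => ν
  have hs0 : 0 ≤ s := integral_sq_nonneg
  have hsa : s ≤ a := H.integral_sq_le_bound
  have hY := H.sum_boundedMeasurable k
  have hT := H.boundedMeasurable.pairSum k
  have hT' := H.boundedMeasurable.pairSum (k + 1)
  have mexp : ∀ {β : Type _} [MeasurableSpace β] {w : β → ℝ}, Measurable w →
      StronglyMeasurable fun q => Complex.exp ((θ * w q : ℝ) * Complex.I) := fun hw => by
    apply Measurable.stronglyMeasurable
    fun_prop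
  rw [integral_pi_succ ν _ (mexp hT'.1) 1 fun x => (Complex.norm_exp_ofReal_mul_I _).le]
  set ψ : (Fin k → E) → ℂ := fun x => ∫ z, Complex.exp ((θ * ∑ i, h z (x i) : ℝ) * Complex.I) ∂ν
    with hψ
  have hψm : StronglyMeasurable ψ :=
    (mexp (hY.1.comp measurable_swap)).integral_prod_right
  have hψ1 : ∀ x, ‖ψ x‖ ≤ 1 := fun x => by
    have := norm_integral_le_of_norm_le_const (μ := ν)
      (f := fun z => Complex.exp ((θ * ∑ i, h z (x i) : ℝ) * Complex.I)) (C := 1)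
      (ae_of_all _ fun z => (Complex.norm_exp_ofReal_mul_I _).le)
    rwa [probReal_univ, mul_one] at this
  have e1 : ∀ x : Fin k → E,
      ∫ z, Complex.exp ((θ * pairSum h (Fin.cons z x : Fin (k + 1) → E) : ℝ) * Complex.I) ∂ν
      = Complex.exp ((θ * pairSum h x : ℝ) * Complex.I) * ψ x := fun x => by
    rw [hψ, ← integral_const_mul]
    congr with z
    rw [pairSum_cons, ← Complex.exp_add]
    congr 1
    push_cast
    ring
  simp_rw [e1]
  set r : ℂ := ((Real.exp (-(θ ^ 2 / 2 * (k * s))) : ℝ) : ℂ) with hr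
  have i1 : Integrable (fun x => Complex.exp ((θ * pairSum h x : ℝ) * Complex.I) * ψ x) π := by
    refine Integrable.of_bound ((mexp hT.1).mul hψm).aestronglyMeasurable 1
      (ae_of_all _ fun x => ?_)
    rw [norm_mul, Complex.norm_exp_ofReal_mul_I, one_mul]
    exact hψ1 x
  have i2 : Integrable (fun x => r * Complex.exp ((θ * pairSum h x : ℝ) * Complex.I)) π :=
    (Integrable.of_bound (mexp hT.1).aestronglyMeasurable 1
      (ae_of_all _ fun x => (Complex.norm_exp_ofReal_mul_I _).le)).const_mul _
  rw [← integral_const_mul, ← integral_sub i1 i2]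
  set v : (Fin k → E) → ℝ := fun x => ∫ z, (∑ i, h z (x i)) ^ 2 ∂ν with hv
  set w : (Fin k → E) → ℝ := fun x => ∫ z, (∑ i, h z (x i)) ^ 4 ∂ν with hw
  have hvb : BoundedMeasurable v := BoundedMeasurable.integral_left
    (f := fun z (x : Fin k → E) => (∑ i, h z (x i)) ^ 2) (hY.pow 2) ν
  have hwb : BoundedMeasurable w := BoundedMeasurable.integral_left
    (f := fun z (x : Fin k → E) => (∑ i, h z (x i)) ^ 4) (hY.pow 4) ν
  have hvs : BoundedMeasurable (fun x => |v x - k * s|) := (hvb.sub (.const _)).abs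
  have hb1 := (BoundedMeasurable.const (2 * |θ| ^ 3)).mul (hvb.add hwb)
  have hb2 := (BoundedMeasurable.const (θ ^ 2 / 2)).mul hvs
  have hpt : ∀ x, ‖Complex.exp ((θ * pairSum h x : ℝ) * Complex.I) * ψ x
      - r * Complex.exp ((θ * pairSum h x : ℝ) * Complex.I)‖
      ≤ 2 * |θ| ^ 3 * (v x + w x) + θ ^ 2 / 2 * |v x - k * s| + (θ ^ 2 / 2 * (k * s)) ^ 2 :=
      fun x => by
    rw [mul_comm r, ← mul_sub, norm_mul, Complex.norm_exp_ofReal_mul_I, one_mul]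
    have hYx : BoundedMeasurable (fun z => ∑ i, h z (x i)) :=
      hY.comp (g := fun z => (z, x)) (by fun_prop)
    have h0 : ∫ z, ∑ i, h z (x i) ∂ν = 0 := by
      rw [integral_finsetSum _ fun i _ => (H.left (x i)).integrable ν]
      simp [H.integral_eq_zero]
    have b1 := norm_integral_cexp_sub_le hYx h0 θ
    have b2 : ‖((1 - θ ^ 2 / 2 * v x : ℝ) : ℂ) - ((1 - θ ^ 2 / 2 * (k * s) : ℝ) : ℂ)‖
        = θ ^ 2 / 2 * |v x - k * s| := by
      rw [← Complex.ofReal_sub, Complex.norm_real, Real.norm_eq_abs,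
        show 1 - θ ^ 2 / 2 * v x - (1 - θ ^ 2 / 2 * (k * s)) = -(θ ^ 2 / 2 * (v x - k * s)) by ring,
        abs_neg, abs_mul, abs_of_nonneg (by positivity)]
    have b3 : ‖((1 - θ ^ 2 / 2 * (k * s) : ℝ) : ℂ) - r‖ ≤ (θ ^ 2 / 2 * (k * s)) ^ 2 := by
      rw [hr, ← Complex.ofReal_sub, Complex.norm_real, Real.norm_eq_abs, abs_sub_comm]
      exact abs_exp_neg_sub_le (by positivity)
    have e : ψ x - r = (ψ x - ((1 - θ ^ 2 / 2 * v x : ℝ) : ℂ))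
        + (((1 - θ ^ 2 / 2 * v x : ℝ) : ℂ) - ((1 - θ ^ 2 / 2 * (k * s) : ℝ) : ℂ))
        + (((1 - θ ^ 2 / 2 * (k * s) : ℝ) : ℂ) - r) := by ring
    rw [e]
    refine (norm_add₃_le).trans (add_le_add (add_le_add b1 b2.le) b3)
  refine (norm_integral_le_of_norm_le ((hb1.add hb2).add (.const _) |>.integrable π)
    (ae_of_all _ hpt)).trans ?_
  rw [integral_add ((hb1.add hb2).integrable π) (integrable_const _),
    integral_add (hb1.integrable π) (hb2.integrable π), integral_const_mul, integral_const_mul,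
    integral_add (hvb.integrable π) (hwb.integrable π)]
  have f1 : ∫ x, v x ∂π = k * s := H.integral_condVar_eq k
  have f2 : ∫ x, w x ∂π ≤ k * a + 3 * k ^ 2 * a ^ 2 := H.integral_condFourth_le k
  have f3 : ∫ x, |v x - k * s| ∂π ≤ √(2 * k * a ^ 2 + 8 * k ^ 2 * b) :=
    H.integral_abs_condVar_sub_le k
  have f4 : k * s ≤ k * a := by gcongr
  have f5 : ∫ x, v x ∂π + ∫ x, w x ∂π ≤ 2 * k * a + 3 * k ^ 2 * a ^ 2 := by linarith
  simp only [integral_const, probReal_univ, one_smul]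
  gcongr

/-- The characteristic function of a degenerate `U`-statistic is close to a Gaussian one. -/
lemma norm_integral_cexp_pairSum_sub_le (hb : 0 ≤ b) (θ : ℝ) (n : ℕ) :
    ‖∫ x, Complex.exp ((θ * pairSum h x : ℝ) * Complex.I) ∂(Measure.pi fun _ : Fin n => ν)
      - (Real.exp (-(θ ^ 2 / 2 * (n * (n - 1) / 2 * ∫ z, ∫ x, h z x ^ 2 ∂ν ∂ν))) : ℝ)‖
      ≤ n * (2 * |θ| ^ 3 * (2 * n * a + 3 * n ^ 2 * a ^ 2)
        + θ ^ 2 / 2 * √(2 * n * a ^ 2 + 8 * n ^ 2 * b) + (θ ^ 2 / 2 * (n * a)) ^ 2) := by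
  set s := ∫ z, ∫ x, h z x ^ 2 ∂ν ∂ν with hs
  have hs0 : 0 ≤ s := integral_sq_nonneg
  have ha := H.bound_nonneg
  set e := 2 * |θ| ^ 3 * (2 * n * a + 3 * n ^ 2 * a ^ 2)
        + θ ^ 2 / 2 * √(2 * n * a ^ 2 + 8 * n ^ 2 * b) + (θ ^ 2 / 2 * (n * a)) ^ 2 with he
  -- The one-step error grows with `k`, so its value `e` at `n` serves for every step; earlier
  -- errors are not amplified since the multipliers `r` have modulus at most `1`.
  suffices ∀ k : ℕ, k ≤ n →
      ‖∫ x, Complex.exp ((θ * pairSum h x : ℝ) * Complex.I) ∂(Measure.pi fun _ : Fin k => ν)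
      - (Real.exp (-(θ ^ 2 / 2 * (k * (k - 1) / 2 * s))) : ℝ)‖ ≤ k * e from this n le_rfl
  intro k
  induction k with
  | zero => simp [pairSum]
  | succ k ih =>
    intro hk
    have ihk := ih (by omega)
    have hkn : (k : ℝ) ≤ n := by exact_mod_cast (by omega : k ≤ n)
    have hstep := H.norm_step_le θ k
    have hle : 2 * |θ| ^ 3 * (2 * k * a + 3 * k ^ 2 * a ^ 2)
        + θ ^ 2 / 2 * √(2 * k * a ^ 2 + 8 * k ^ 2 * b) + (θ ^ 2 / 2 * (k * a)) ^ 2 ≤ e := by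
      rw [he]
      gcongr
    set r := Real.exp (-(θ ^ 2 / 2 * (k * s))) with hr
    have hr1 : ‖(r : ℂ)‖ ≤ 1 := by
      rw [Complex.norm_real, Real.norm_eq_abs, abs_of_pos (Real.exp_pos _)]
      exact Real.exp_le_one_iff.2 (neg_nonpos.2 (by positivity))
    have hexp : Real.exp (-(θ ^ 2 / 2 * (((k + 1 : ℕ) : ℝ) * (((k + 1 : ℕ) : ℝ) - 1) / 2 * s)))
        = r * Real.exp (-(θ ^ 2 / 2 * (k * (k - 1) / 2 * s))) := by
      rw [hr, ← Real.exp_add]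
      congr 1
      push_cast
      ring
    rw [hexp]
    set φ' := ∫ x, Complex.exp ((θ * pairSum h x : ℝ) * Complex.I)
      ∂(Measure.pi fun _ : Fin (k + 1) => ν)
    set φ := ∫ x, Complex.exp ((θ * pairSum h x : ℝ) * Complex.I)
      ∂(Measure.pi fun _ : Fin k => ν)
    set g := Real.exp (-(θ ^ 2 / 2 * (k * (k - 1) / 2 * s)))
    calc ‖φ' - ((r * g : ℝ) : ℂ)‖ = ‖(φ' - r * φ) + r * (φ - g)‖ := by
          congr 1
          push_cast
          ring
      _ ≤ e + 1 * (k * e) := by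
          refine (norm_add_le _ _).trans (add_le_add (hstep.trans hle) ?_)
          rw [norm_mul]
          exact mul_le_mul hr1 ihk (norm_nonneg _) zero_le_one
      _ = ((k + 1 : ℕ) : ℝ) * e := by
          push_cast
          ring

end DegenerateKernel

end DegenerateUStatistic

/-! ### Symmetries of the projected product law. -/

section SphereProj

variable {p : ℕ}

@[simp]
lemma sphereProj_apply (x : Fin p → ℝ) (i : Fin p) :
    sphereProj x i = x i / √(∑ k, x k ^ 2) := rfl

lemma measurable_sphereProj : Measurable (sphereProj : (Fin p → ℝ) → EuclideanSpace ℝ (Fin p)) := by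
  unfold sphereProj
  exact (WithLp.measurable_toLp 2 _).comp (by fun_prop)

variable (μ : Measure ℝ) [IsProbabilityMeasure μ]

/-- The normalising factor depends only on squares, so projection commutes with a change of sign of
one coordinate, which preserves the product law. -/
lemma integral_map_sphereProj_update_neg (hsymm : μ.map (fun y => -y) = μ) (a : Fin p)
    (F : (Fin p → ℝ) → ℝ) (hF : Measurable F) :
    ∫ z, F (fun i => (if i = a then -1 else 1) * z i)
        ∂((Measure.pi fun _ : Fin p => μ).map sphereProj)
      = ∫ z, F (fun i => z i) ∂((Measure.pi fun _ : Fin p => μ).map sphereProj) := by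
  have hT : MeasurePreserving (fun (x : Fin p → ℝ) i => (if i = a then (-1 : ℝ) else 1) * x i)
      (Measure.pi fun _ : Fin p => μ) (Measure.pi fun _ : Fin p => μ) := by
    refine measurePreserving_pi (f := fun i y => (if i = a then (-1 : ℝ) else 1) * y) _ _
      fun i => ⟨by fun_prop, ?_⟩
    split_ifs
    · simpa using hsymm
    · simp
  have hm : ∀ s : Fin p → ℝ,
      Measurable fun z : EuclideanSpace ℝ (Fin p) => F (fun i => s i * z i) :=
    fun s => hF.comp (by fun_prop)
  have hm' : Measurable fun z : EuclideanSpace ℝ (Fin p) => F (fun i => z i) := hF.comp (by fun_prop)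
  have hm'' : Measurable fun x : Fin p → ℝ => F (fun i => sphereProj x i) :=
    hm'.comp measurable_sphereProj
  rw [integral_map measurable_sphereProj.aemeasurable (hm _).aestronglyMeasurable,
    integral_map measurable_sphereProj.aemeasurable hm'.aestronglyMeasurable]
  conv_rhs => rw [← hT.map_eq]
  rw [integral_map hT.measurable.aemeasurable
    hm''.aestronglyMeasurable]
  congr with x
  congr 1
  ext i
  have e : ∀ k, ((if k = a then (-1 : ℝ) else 1) * x k) ^ 2 = x k ^ 2 := fun k => by
    split_ifs <;> ring
  simp only [sphereProj_apply, e, mul_div_assoc]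

lemma integral_map_sphereProj_perm (σ : Equiv.Perm (Fin p))
    (F : (Fin p → ℝ) → ℝ) (hF : Measurable F) :
    ∫ z, F (fun i => z (σ i)) ∂((Measure.pi fun _ : Fin p => μ).map sphereProj)
      = ∫ z, F (fun i => z i) ∂((Measure.pi fun _ : Fin p => μ).map sphereProj) := by
  have hT : MeasurePreserving (fun (x : Fin p → ℝ) i => x (σ i))
      (Measure.pi fun _ : Fin p => μ) (Measure.pi fun _ : Fin p => μ) :=
    (measurePreserving_piCongrLeft (fun _ : Fin p => μ) σ).symm
  have hm : Measurable fun z : EuclideanSpace ℝ (Fin p) => F (fun i => z (σ i)) :=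
    hF.comp (by fun_prop)
  have hm' : Measurable fun z : EuclideanSpace ℝ (Fin p) => F (fun i => z i) := hF.comp (by fun_prop)
  have hm'' : Measurable fun x : Fin p → ℝ => F (fun i => sphereProj x i) :=
    hm'.comp measurable_sphereProj
  rw [integral_map measurable_sphereProj.aemeasurable hm.aestronglyMeasurable,
    integral_map measurable_sphereProj.aemeasurable hm'.aestronglyMeasurable]
  conv_rhs => rw [← hT.map_eq]
  rw [integral_map hT.measurable.aemeasurable
    hm''.aestronglyMeasurable]
  congr with x
  congr 1
  ext i
  simp only [sphereProj_apply]
  rw [Equiv.sum_comp σ (fun k => x k ^ 2)]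

end SphereProj

/-- A law on the unit sphere of `ℝᵖ` whose second and fourth mixed moments are those of a law that
is invariant under the signed permutations of the coordinates, with `m₄ = E Z₁⁴` and
`m₂₂ = E Z₁² Z₂²`. -/
structure HasSphericalMoments {p : ℕ} (ν : Measure (EuclideanSpace ℝ (Fin p))) (m₄ m₂₂ : ℝ) :
    Prop where
  sphere : ∀ᵐ x ∂ν, ‖x‖ = 1
  fourth_nonneg : 0 ≤ m₄
  mixed_nonneg : 0 ≤ m₂₂
  sum_eq_one : p * m₄ + p * (p - 1) * m₂₂ = 1
  second : ∀ k l, ∫ z, z k * z l ∂ν = if k = l then (p : ℝ)⁻¹ else 0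
  fourth : ∀ k l m q, ∫ z, z k * z l * (z m * z q) ∂ν
    = m₂₂ * ((if k = l then 1 else 0) * (if m = q then 1 else 0)
      + (if k = m then 1 else 0) * (if l = q then 1 else 0)
      + (if k = q then 1 else 0) * (if l = m then 1 else 0))
      + (m₄ - 3 * m₂₂) * ((if k = l then 1 else 0) * (if k = m then 1 else 0)
        * (if k = q then 1 else 0))

/-! ### Mixed moments on the sphere. -/

section Moments

variable {p : ℕ} {ν : Measure (EuclideanSpace ℝ (Fin p))} [IsProbabilityMeasure ν]

lemma sum_sq_eq_one_of_norm {x : EuclideanSpace ℝ (Fin p)} (hx : ‖x‖ = 1) :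
    ∑ i, x i ^ 2 = 1 := by
  have := EuclideanSpace.real_norm_sq_eq x
  rw [hx] at this
  linarith

lemma abs_apply_le_one_of_norm {x : EuclideanSpace ℝ (Fin p)} (hx : ‖x‖ = 1) (i : Fin p) :
    |x i| ≤ 1 := by
  rw [← sq_le_one_iff_abs_le_one, ← sum_sq_eq_one_of_norm hx]
  exact Finset.single_le_sum (f := fun i => x i ^ 2) (fun _ _ => sq_nonneg _) (Finset.mem_univ i)

lemma integrable_second (hS : ∀ᵐ x ∂ν, ‖x‖ = 1) (k l : Fin p) :
    Integrable (fun z => z k * z l) ν := by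
  refine Integrable.of_bound (by fun_prop) 1 (hS.mono fun z hz => ?_)
  rw [Real.norm_eq_abs, abs_mul]
  exact mul_le_one₀ (abs_apply_le_one_of_norm hz k) (abs_nonneg _) (abs_apply_le_one_of_norm hz l)

lemma integrable_fourth (hS : ∀ᵐ x ∂ν, ‖x‖ = 1) (k l m q : Fin p) :
    Integrable (fun z => z k * z l * (z m * z q)) ν := by
  refine Integrable.of_bound (by fun_prop) 1 (hS.mono fun z hz => ?_)
  have h := abs_apply_le_one_of_norm hz
  rw [Real.norm_eq_abs, abs_mul, abs_mul, abs_mul]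
  exact mul_le_one₀ (mul_le_one₀ (h k) (abs_nonneg _) (h l)) (by positivity)
    (mul_le_one₀ (h m) (abs_nonneg _) (h q))

lemma exists_perm_apply_pair {k l k' l' : Fin p} (h : k ≠ l) (h' : k' ≠ l') :
    ∃ σ : Equiv.Perm (Fin p), σ k = k' ∧ σ l = l' := by
  refine ⟨(Equiv.swap k k').trans (Equiv.swap (Equiv.swap k k' l) l'), ?_, ?_⟩
  · have h1 : Equiv.swap k k' l ≠ k' := fun e => by
      have := (Equiv.swap k k').injective (e.trans (Equiv.swap_apply_left k k').symm)
      exact h this.symm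
    simp only [Equiv.trans_apply, Equiv.swap_apply_left]
    exact Equiv.swap_apply_of_ne_of_ne h1.symm h'
  · simp

/-- Sign changes kill every mixed moment in which some index occurs an odd number of times, and
permutations identify the remaining ones. Integrating `(∑ z_k²)² = 1` links `m₄` and `m₂₂`; `2 ≤ p`
provides the two distinct indices that define `m₂₂`. -/
lemma hasSphericalMoments_map_sphereProj (μ : Measure ℝ) [IsProbabilityMeasure μ]
    (hsymm : μ.map (fun y => -y) = μ) (hp : 2 ≤ p)
    (hν : ν = (Measure.pi fun _ : Fin p => μ).map sphereProj) (hS : ∀ᵐ x ∂ν, ‖x‖ = 1) :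
    ∃ m₂₂, HasSphericalMoments ν ((p : ℝ)⁻¹ * ∫ z, ∑ k, z k ^ 4 ∂ν) m₂₂ := by
  have hp0 : (p : ℝ) ≠ 0 := by positivity
  have flip2 : ∀ a k l : Fin p, ∫ z, z k * z l ∂ν
      = (if k = a then -1 else 1) * (if l = a then -1 else 1) * ∫ z, z k * z l ∂ν :=
      fun a k l => by
    conv_lhs => rw [hν]
    rw [← integral_map_sphereProj_update_neg μ hsymm a (fun z => z k * z l) (by fun_prop), ← hν,
      ← integral_const_mul]
    congr with z
    ring
  have flip4 : ∀ a k l m q : Fin p, ∫ z, z k * z l * (z m * z q) ∂ν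
      = (if k = a then -1 else 1) * (if l = a then -1 else 1) * ((if m = a then -1 else 1)
        * (if q = a then -1 else 1)) * ∫ z, z k * z l * (z m * z q) ∂ν := fun a k l m q => by
    conv_lhs => rw [hν]
    rw [← integral_map_sphereProj_update_neg μ hsymm a (fun z => z k * z l * (z m * z q))
      (by fun_prop), ← hν, ← integral_const_mul]
    congr with z
    ring
  have perm2 : ∀ (σ : Equiv.Perm (Fin p)) (k l : Fin p),
      ∫ z, z (σ k) * z (σ l) ∂ν = ∫ z, z k * z l ∂ν := fun σ k l => by
    rw [hν]
    exact integral_map_sphereProj_perm μ σ (fun z => z k * z l) (by fun_prop)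
  have perm4 : ∀ (σ : Equiv.Perm (Fin p)) (k l m q : Fin p),
      ∫ z, z (σ k) * z (σ l) * (z (σ m) * z (σ q)) ∂ν = ∫ z, z k * z l * (z m * z q) ∂ν :=
      fun σ k l m q => by
    rw [hν]
    exact integral_map_sphereProj_perm μ σ (fun z => z k * z l * (z m * z q)) (by fun_prop)
  set i₀ : Fin p := ⟨0, by omega⟩ with hi₀
  set i₁ : Fin p := ⟨1, by omega⟩ with hi₁
  have h01 : i₀ ≠ i₁ := by simp [hi₀, hi₁]
  set m₄ := ∫ z, z i₀ * z i₀ * (z i₀ * z i₀) ∂ν with hm₄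
  set m₂₂ := ∫ z, z i₀ * z i₀ * (z i₁ * z i₁) ∂ν with hm₂₂
  have e4 : ∀ k, ∫ z, z k * z k * (z k * z k) ∂ν = m₄ := fun k => by
    rw [hm₄, ← perm4 (Equiv.swap i₀ k)]
    simp
  have e22 : ∀ k l, k ≠ l → ∫ z, z k * z k * (z l * z l) ∂ν = m₂₂ := fun k l hkl => by
    obtain ⟨σ, h1, h2⟩ := exists_perm_apply_pair h01 hkl
    rw [hm₂₂, ← perm4 σ i₀ i₀ i₁ i₁, h1, h2]
  have e2 : ∀ k, ∫ z, z k * z k ∂ν = ∫ z, z i₀ * z i₀ ∂ν := fun k => by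
    rw [← perm2 (Equiv.swap i₀ k) i₀ i₀]
    simp
  have hm4 : (p : ℝ)⁻¹ * ∫ z, ∑ k, z k ^ 4 ∂ν = m₄ := by
    have e : ∀ z : EuclideanSpace ℝ (Fin p), ∑ k, z k ^ 4 = ∑ k, z k * z k * (z k * z k) :=
      fun z => Finset.sum_congr rfl fun k _ => by ring
    simp_rw [e]
    rw [integral_finsetSum _ fun k _ => integrable_fourth hS k k k k]
    simp_rw [e4]
    simp [hp0]
  rw [hm4]
  refine ⟨m₂₂, hS, integral_nonneg fun z => ?_, integral_nonneg fun z => ?_, ?_, ?_, ?_⟩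
  · exact mul_nonneg (mul_self_nonneg _) (mul_self_nonneg _)
  · exact mul_nonneg (mul_self_nonneg _) (mul_self_nonneg _)
  · have h1 : ∫ z, ∑ k, ∑ l, z k * z k * (z l * z l) ∂ν = 1 := by
      have : ∀ᵐ z ∂ν, ∑ k, ∑ l, z k * z k * (z l * z l) = 1 := hS.mono fun z hz => by
        rw [← Finset.sum_mul_sum]
        simp_rw [← pow_two]
        rw [sum_sq_eq_one_of_norm hz]
        norm_num
      rw [integral_congr_ae this]
      simp
    rw [integral_finsetSum _ fun k _ => integrable_finsetSum _ fun l _ =>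
      integrable_fourth hS k k l l] at h1
    simp_rw [integral_finsetSum _ fun l _ => integrable_fourth hS _ _ l l] at h1
    have h2 : ∀ k, ∑ l, ∫ z, z k * z k * (z l * z l) ∂ν = m₄ + (p - 1) * m₂₂ := fun k => by
      rw [← Finset.add_sum_erase _ _ (Finset.mem_univ k), e4,
        Finset.sum_congr rfl fun l hl => e22 k l (Finset.ne_of_mem_erase hl).symm]
      simp [Finset.card_erase_of_mem, Nat.cast_sub (by omega : 1 ≤ p)]
    simp_rw [h2] at h1
    simp at h1
    linarith
  · intro k l
    split_ifs with h
    · subst h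
      have h1 : ∫ z, ∑ k, z k * z k ∂ν = 1 := by
        have : ∀ᵐ z ∂ν, ∑ k, z k * z k = 1 := hS.mono fun z hz => by
          simp_rw [← pow_two]
          rw [sum_sq_eq_one_of_norm hz]
        rw [integral_congr_ae this]
        simp
      rw [integral_finsetSum _ fun k _ => integrable_second hS k k] at h1
      simp_rw [e2] at h1
      simp at h1
      rw [e2, eq_inv_of_mul_eq_one_right h1]
    · have := flip2 k k l
      rw [if_pos rfl, if_neg (Ne.symm h)] at this
      linarith
  · intro k l m q
    -- Flipping the sign of an index of odd multiplicity states that the moment equals its own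
    -- negative; each vanishing case below uses one of these four identities.
    have hk := flip4 k k l m q
    have hl := flip4 l k l m q
    have hm := flip4 m k l m q
    have hq := flip4 q k l m q
    by_cases h1 : k = l
    · subst h1
      by_cases h2 : m = q
      · subst h2
        by_cases h3 : k = m
        · subst h3
          rw [e4]
          simp
          ring
        · rw [e22 k m h3]
          simp [h3]
      · have : ∫ z, z k * z k * (z m * z q) ∂ν = 0 := by
          by_cases h3 : k = m
          · subst h3
            simp [h2] at hq
            linarith
          · simp [h3, Ne.symm h2] at hm
            linarith
        rw [this]
        by_cases h3 : k = m
        · subst h3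
          simp [h2]
        · simp [h2, h3]
    · by_cases h2 : k = m
      · subst h2
        by_cases h3 : l = q
        · subst h3
          have : ∀ z : EuclideanSpace ℝ (Fin p), z k * z l * (z k * z l)
              = z k * z k * (z l * z l) := fun z => by ring
          simp_rw [this]
          rw [e22 k l h1]
          simp [h1]
        · have : ∫ z, z k * z l * (z k * z q) ∂ν = 0 := by
            simp [h1, Ne.symm h3] at hl
            linarith
          rw [this]
          simp [h1, h3, Ne.symm h1]
      · by_cases h3 : k = q
        · subst h3
          by_cases h4 : l = m
          · subst h4
            have : ∀ z : EuclideanSpace ℝ (Fin p), z k * z l * (z l * z k)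
                = z k * z k * (z l * z l) := fun z => by ring
            simp_rw [this]
            rw [e22 k l h1]
            simp [h1]
          · have : ∫ z, z k * z l * (z m * z k) ∂ν = 0 := by
              simp [h1, Ne.symm h4] at hl
              linarith
            rw [this]
            simp [h1, h2, h4]
        · have : ∫ z, z k * z l * (z m * z q) ∂ν = 0 := by
            simp [Ne.symm h1, Ne.symm h2, Ne.symm h3] at hk
            linarith
          rw [this]
          simp [h1, h2, h3]

end Moments

/-! ### Moments of inner products. -/

section FourthOrder

variable {p : ℕ} {ν : Measure (EuclideanSpace ℝ (Fin p))} [IsProbabilityMeasure ν]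

lemma inner_eq_sum_mul (x y : EuclideanSpace ℝ (Fin p)) : inner ℝ x y = ∑ i, x i * y i := by
  rw [PiLp.inner_apply]
  exact Finset.sum_congr rfl fun i _ => by simp [mul_comm]

namespace HasSphericalMoments

variable {m₄ m₂₂ : ℝ} (H : HasSphericalMoments ν m₄ m₂₂)
include H

lemma integral_inner_sq (x : EuclideanSpace ℝ (Fin p)) :
    ∫ z, (inner ℝ z x) ^ 2 ∂ν = (p : ℝ)⁻¹ * ‖x‖ ^ 2 := by
  have e : ∀ z : EuclideanSpace ℝ (Fin p),
      (inner ℝ z x) ^ 2 = ∑ k, ∑ l, x k * x l * (z k * z l) := fun z => by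
    rw [inner_eq_sum_mul, pow_two, Finset.sum_mul_sum]
    exact Finset.sum_congr rfl fun k _ => Finset.sum_congr rfl fun l _ => by ring
  have i := fun k l => (integrable_second H.sphere k l).const_mul (x k * x l)
  simp_rw [e]
  rw [integral_finsetSum _ fun k _ => integrable_finsetSum _ fun l _ => i k l]
  simp_rw [integral_finsetSum _ fun l _ => i _ l, integral_const_mul, H.second]
  simp only [mul_ite, mul_zero, Finset.sum_ite_eq, Finset.mem_univ, if_true]
  rw [EuclideanSpace.real_norm_sq_eq, Finset.mul_sum]
  exact Finset.sum_congr rfl fun k _ => by ring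

/-- The moment tensor is `m₂₂` times the three Gaussian pairings plus a diagonal defect `m₄ - 3
m₂₂`. The pairings contract to norms and inner products, the defect to `∑ x_k² y_k²`. -/
lemma integral_inner_sq_mul_inner_sq (x y : EuclideanSpace ℝ (Fin p)) :
    ∫ z, (inner ℝ z x) ^ 2 * (inner ℝ z y) ^ 2 ∂ν
      = (m₄ - 3 * m₂₂) * ∑ k, x k ^ 2 * y k ^ 2
        + m₂₂ * (‖x‖ ^ 2 * ‖y‖ ^ 2 + 2 * (inner ℝ x y) ^ 2) := by
  have e : ∀ z : EuclideanSpace ℝ (Fin p), (inner ℝ z x) ^ 2 * (inner ℝ z y) ^ 2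
      = ∑ k, ∑ l, ∑ m, ∑ q, x k * x l * (y m * y q) * (z k * z l * (z m * z q)) := fun z => by
    rw [inner_eq_sum_mul, inner_eq_sum_mul, pow_two, pow_two, Finset.sum_mul_sum,
      Finset.sum_mul_sum, Finset.sum_mul_sum]
    simp_rw [Finset.sum_mul_sum]
    refine Finset.sum_congr rfl fun k _ => ?_
    rw [Finset.sum_comm]
    exact Finset.sum_congr rfl fun l _ => Finset.sum_congr rfl fun m _ =>
      Finset.sum_congr rfl fun q _ => by ring
  have i := fun k l m q =>
    (integrable_fourth H.sphere k l m q).const_mul (x k * x l * (y m * y q))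
  simp_rw [e]
  rw [integral_finsetSum _ fun k _ => integrable_finsetSum _ fun l _ =>
    integrable_finsetSum _ fun m _ => integrable_finsetSum _ fun q _ => i k l m q]
  simp_rw [integral_finsetSum _ fun l _ => integrable_finsetSum _ fun m _ =>
    integrable_finsetSum _ fun q _ => i _ l m q, integral_finsetSum _ fun m _ =>
    integrable_finsetSum _ fun q _ => i _ _ m q, integral_finsetSum _ fun q _ => i _ _ _ q,
    integral_const_mul, H.fourth]
  have hx : ‖x‖ ^ 2 * ‖y‖ ^ 2 = ∑ k, ∑ m, x k ^ 2 * y m ^ 2 := by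
    rw [EuclideanSpace.real_norm_sq_eq, EuclideanSpace.real_norm_sq_eq, Finset.sum_mul_sum]
  have hxy : (inner ℝ x y) ^ 2 = ∑ k, ∑ m, x k * x m * (y k * y m) := by
    rw [inner_eq_sum_mul, pow_two, Finset.sum_mul_sum]
    exact Finset.sum_congr rfl fun k _ => Finset.sum_congr rfl fun m _ => by ring
  have s1 : ∑ k, ∑ l, ∑ m, ∑ q, x k * x l * (y m * y q) *
      ((if k = l then (1 : ℝ) else 0) * (if m = q then 1 else 0)) = ‖x‖ ^ 2 * ‖y‖ ^ 2 := by
    rw [hx]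
    simp [pow_two]
  have s2 : ∑ k, ∑ l, ∑ m, ∑ q, x k * x l * (y m * y q) *
      ((if k = m then (1 : ℝ) else 0) * (if l = q then 1 else 0)) = (inner ℝ x y) ^ 2 := by
    rw [hxy]
    simp
  have s3 : ∑ k, ∑ l, ∑ m, ∑ q, x k * x l * (y m * y q) *
      ((if k = q then (1 : ℝ) else 0) * (if l = m then 1 else 0)) = (inner ℝ x y) ^ 2 := by
    rw [hxy]
    simp
    exact Finset.sum_congr rfl fun k _ => Finset.sum_congr rfl fun m _ => by ring
  have s4 : ∑ k, ∑ l, ∑ m, ∑ q, x k * x l * (y m * y q) *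
      ((if k = l then (1 : ℝ) else 0) * (if k = m then 1 else 0) * (if k = q then 1 else 0))
      = ∑ k, x k ^ 2 * y k ^ 2 := by
    simp [pow_two]
  rw [← s4, mul_add, mul_left_comm m₂₂ 2, two_mul, ← mul_add]
  nth_rw 1 [← s2]
  rw [← s3, ← s1]
  simp only [Finset.mul_sum, ← Finset.sum_add_distrib]
  exact Finset.sum_congr rfl fun k _ => Finset.sum_congr rfl fun l _ =>
    Finset.sum_congr rfl fun m _ => Finset.sum_congr rfl fun q _ => by ring

end HasSphericalMoments

end FourthOrder

/-! ### The Bingham kernel is degenerate. -/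

section BinghamKernel

variable {p : ℕ}

open Classical in
/-- The kernel `(xᵀ y)² - 1 / p` of the Bingham statistic, restricted to the unit sphere. -/
noncomputable def binghamKernel (x y : EuclideanSpace ℝ (Fin p)) : ℝ :=
  if ‖x‖ = 1 ∧ ‖y‖ = 1 then (inner ℝ x y) ^ 2 - (p : ℝ)⁻¹ else 0

lemma binghamKernel_of_norm {x y : EuclideanSpace ℝ (Fin p)} (hx : ‖x‖ = 1) (hy : ‖y‖ = 1) :
    binghamKernel x y = (inner ℝ x y) ^ 2 - (p : ℝ)⁻¹ := if_pos ⟨hx, hy⟩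

lemma binghamKernel_of_norm_ne {x y : EuclideanSpace ℝ (Fin p)} (hy : ‖y‖ ≠ 1) :
    binghamKernel x y = 0 := if_neg fun h => hy h.2

lemma binghamKernel_symm (x y : EuclideanSpace ℝ (Fin p)) :
    binghamKernel x y = binghamKernel y x := by
  unfold binghamKernel
  rw [real_inner_comm]
  simp only [and_comm]

lemma measurable_binghamKernel :
    Measurable (Function.uncurry (binghamKernel (p := p))) := by
  unfold binghamKernel Function.uncurry
  refine Measurable.ite ?_ (by fun_prop) measurable_const
  exact (measurableSet_eq_fun (by fun_prop) measurable_const).inter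
    (measurableSet_eq_fun (by fun_prop) measurable_const)

lemma inner_sq_le_one {x y : EuclideanSpace ℝ (Fin p)} (hx : ‖x‖ = 1) (hy : ‖y‖ = 1) :
    (inner ℝ x y) ^ 2 ≤ 1 := by
  rw [sq_le_one_iff_abs_le_one]
  simpa [hx, hy] using abs_real_inner_le_norm x y

/-- Setting the kernel to `0` off the sphere makes this hold for all points rather than almost all,
as `DegenerateKernel` demands. -/
lemma abs_binghamKernel_le_one (x y : EuclideanSpace ℝ (Fin p)) : |binghamKernel x y| ≤ 1 := by
  unfold binghamKernel
  split_ifs with h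
  · have h1 := inner_sq_le_one h.1 h.2
    have h2 := sq_nonneg (inner ℝ x y)
    have h3 : (p : ℝ)⁻¹ ≤ 1 := Nat.cast_inv_le_one p
    have h4 : 0 ≤ (p : ℝ)⁻¹ := by positivity
    rw [abs_le]
    constructor <;> linarith
  · simp

lemma sum_sq_mul_sq_le_one {x y : EuclideanSpace ℝ (Fin p)} (hx : ‖x‖ = 1) (hy : ‖y‖ = 1) :
    ∑ k, x k ^ 2 * y k ^ 2 ≤ 1 := by
  rw [← sum_sq_eq_one_of_norm hx]
  refine Finset.sum_le_sum fun k _ => mul_le_of_le_one_right (sq_nonneg _) ?_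
  exact (sq_le_one_iff_abs_le_one _).2 (abs_apply_le_one_of_norm hy k)

namespace HasSphericalMoments

variable {ν : Measure (EuclideanSpace ℝ (Fin p))} [IsProbabilityMeasure ν]
  {m₄ m₂₂ : ℝ} (H : HasSphericalMoments ν m₄ m₂₂)

omit [IsProbabilityMeasure ν] in
lemma fourth_le (H : HasSphericalMoments ν m₄ m₂₂) (hp : 2 ≤ p) : m₄ ≤ (p : ℝ)⁻¹ := by
  have hp2 : (2 : ℝ) ≤ p := by exact_mod_cast hp
  have h1 := H.sum_eq_one
  have h2 : 0 ≤ p * ((p : ℝ) - 1) * m₂₂ :=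
    mul_nonneg (mul_nonneg (by linarith) (by linarith)) H.mixed_nonneg
  rw [inv_eq_one_div, le_div_iff₀ (by linarith)]
  linarith

omit [IsProbabilityMeasure ν] in
-- `p (p - 1) m₂₂ ≤ 1`, and `p² ≤ 2 p (p - 1)` for `p ≥ 2`.
lemma mixed_le (H : HasSphericalMoments ν m₄ m₂₂) (hp : 2 ≤ p) : m₂₂ ≤ 2 * ((p : ℝ)⁻¹) ^ 2 := by
  have hp2 : (2 : ℝ) ≤ p := by exact_mod_cast hp
  have h1 := H.sum_eq_one
  have h2 : 0 ≤ p * m₄ := mul_nonneg (by linarith) H.fourth_nonneg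
  have h3 : (p : ℝ) ^ 2 * m₂₂ ≤ 2 := by nlinarith [H.mixed_nonneg, mul_nonneg (mul_nonneg
    (by linarith : (0 : ℝ) ≤ p) (by linarith : (0 : ℝ) ≤ p - 2)) H.mixed_nonneg]
  rw [inv_pow, ← div_eq_mul_inv, le_div_iff₀ (by positivity)]
  linarith

include H

lemma integrable_inner_sq {x : EuclideanSpace ℝ (Fin p)} (hx : ‖x‖ = 1) :
    Integrable (fun z => (inner ℝ z x) ^ 2) ν :=
  Integrable.of_bound (by fun_prop) 1 (H.sphere.mono fun z hz => by
    rw [Real.norm_eq_abs, abs_of_nonneg (sq_nonneg _)]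
    exact inner_sq_le_one hz hx)

lemma integral_binghamKernel (x : EuclideanSpace ℝ (Fin p)) : ∫ z, binghamKernel z x ∂ν = 0 := by
  by_cases hx : ‖x‖ = 1
  · rw [integral_congr_ae (H.sphere.mono fun z hz => binghamKernel_of_norm hz hx),
      integral_sub (H.integrable_inner_sq hx) (integrable_const _), H.integral_inner_sq, hx]
    simp
  · simp [binghamKernel_of_norm_ne hx]

lemma integral_binghamKernel_mul {x y : EuclideanSpace ℝ (Fin p)} (hx : ‖x‖ = 1) (hy : ‖y‖ = 1) :
    ∫ z, binghamKernel z x * binghamKernel z y ∂ν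
      = (m₄ - 3 * m₂₂) * ∑ k, x k ^ 2 * y k ^ 2 + 2 * m₂₂ * (inner ℝ x y) ^ 2
        + (m₂₂ - ((p : ℝ)⁻¹) ^ 2) := by
  have e : ∀ᵐ z ∂ν, binghamKernel z x * binghamKernel z y
      = (inner ℝ z x) ^ 2 * (inner ℝ z y) ^ 2 - (p : ℝ)⁻¹ * (inner ℝ z x) ^ 2
        - (p : ℝ)⁻¹ * (inner ℝ z y) ^ 2 + ((p : ℝ)⁻¹) ^ 2 := H.sphere.mono fun z hz => by
    rw [binghamKernel_of_norm hz hx, binghamKernel_of_norm hz hy]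
    ring
  have ix := H.integrable_inner_sq hx
  have iy := H.integrable_inner_sq hy
  have ixy : Integrable (fun z => (inner ℝ z x) ^ 2 * (inner ℝ z y) ^ 2) ν :=
    Integrable.of_bound (by fun_prop) 1 (H.sphere.mono fun z hz => by
      rw [Real.norm_eq_abs, abs_of_nonneg (by positivity)]
      exact mul_le_one₀ (inner_sq_le_one hz hx) (sq_nonneg _) (inner_sq_le_one hz hy))
  have i1 : Integrable (fun z => (inner ℝ z x) ^ 2 * (inner ℝ z y) ^ 2
      - (p : ℝ)⁻¹ * (inner ℝ z x) ^ 2) ν := ixy.sub (ix.const_mul _)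
  have i2 : Integrable (fun z => (inner ℝ z x) ^ 2 * (inner ℝ z y) ^ 2
      - (p : ℝ)⁻¹ * (inner ℝ z x) ^ 2 - (p : ℝ)⁻¹ * (inner ℝ z y) ^ 2) ν := i1.sub (iy.const_mul _)
  rw [integral_congr_ae e, integral_add i2 (integrable_const _), integral_sub i1 (iy.const_mul _),
    integral_sub ixy (ix.const_mul _), integral_const_mul, integral_const_mul,
    H.integral_inner_sq, H.integral_inner_sq, H.integral_inner_sq_mul_inner_sq, hx, hy]
  simp
  ring

/-- On the sphere the integral is at most `m₄ + 3 m₂₂`, where `m₄ ≤ 1/p` and `3 m₂₂ ≤ 6/p² ≤ 3/p`.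
-/
lemma integral_binghamKernel_sq_le (hp : 2 ≤ p) (x : EuclideanSpace ℝ (Fin p)) :
    ∫ z, binghamKernel z x ^ 2 ∂ν ≤ 4 * (p : ℝ)⁻¹ := by
  by_cases hx : ‖x‖ = 1
  · have h1 : ∑ k, x k ^ 2 * x k ^ 2 ≤ 1 := sum_sq_mul_sq_le_one hx hx
    have h0 : 0 ≤ ∑ k, x k ^ 2 * x k ^ 2 := Finset.sum_nonneg fun k _ => by positivity
    have h2 := H.fourth_nonneg
    have h3 := H.mixed_nonneg
    have h4 := H.fourth_le hp
    have h5 := H.mixed_le hp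
    have hp2 : (2 : ℝ) ≤ p := by exact_mod_cast hp
    have h6 : (p : ℝ)⁻¹ ≤ 2⁻¹ := inv_anti₀ (by norm_num) hp2
    have h7 : 0 ≤ (p : ℝ)⁻¹ := by positivity
    have h8 : 2 * ((p : ℝ)⁻¹) ^ 2 ≤ (p : ℝ)⁻¹ := by nlinarith
    simp_rw [pow_two (binghamKernel _ _)]
    rw [H.integral_binghamKernel_mul hx hx, real_inner_self_eq_norm_sq, hx]
    nlinarith [mul_nonneg h2 (sub_nonneg.2 h1), mul_nonneg h3 h0]
  · simp only [binghamKernel_of_norm_ne hx]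
    simp

lemma integral_sum_sq_mul_sq {x : EuclideanSpace ℝ (Fin p)} (hx : ‖x‖ = 1) :
    ∫ y, ∑ k, x k ^ 2 * y k ^ 2 ∂ν = (p : ℝ)⁻¹ := by
  have e : ∀ y : EuclideanSpace ℝ (Fin p), ∑ k, x k ^ 2 * y k ^ 2
      = ∑ k, x k ^ 2 * (y k * y k) := fun y => Finset.sum_congr rfl fun k _ => by ring
  simp_rw [e]
  rw [integral_finsetSum _ fun k _ => (integrable_second H.sphere k k).const_mul _]
  simp_rw [integral_const_mul, H.second, if_true]
  rw [← Finset.sum_mul, sum_sq_eq_one_of_norm hx, one_mul]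

/-- The iterated kernel is `O(1/p) Q + O(1/p²) R + O(1/p²)` with `Q = ∑ x_k² y_k²` and `R = (xᵀy)²`
in `[0, 1]`. Since `Q² ≤ Q`, `R² ≤ R` and both have mean `1/p` in `y`, the dominant square
contributes `p⁻² · p⁻¹`. -/
lemma integral_binghamKernel_iterate_sq_le (hp : 2 ≤ p) :
    ∫ x, ∫ y, (∫ z, binghamKernel z x * binghamKernel z y ∂ν) ^ 2 ∂ν ∂ν
      ≤ 108 * ((p : ℝ)⁻¹) ^ 3 := by
  have h2 := H.fourth_nonneg
  have h3 := H.mixed_nonneg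
  have h4 := H.fourth_le hp
  have h5 := H.mixed_le hp
  have hp2 : (2 : ℝ) ≤ p := by exact_mod_cast hp
  set r := (p : ℝ)⁻¹ with hr
  have h6 : r ≤ 2⁻¹ := inv_anti₀ (by norm_num) hp2
  have h7 : 0 ≤ r := by positivity
  have hx : ∀ x : EuclideanSpace ℝ (Fin p), ‖x‖ = 1 →
      ∫ y, (∫ z, binghamKernel z x * binghamKernel z y ∂ν) ^ 2 ∂ν ≤ 108 * r ^ 3 := fun x hx => by
    have iQ : Integrable (fun y : EuclideanSpace ℝ (Fin p) => ∑ k, x k ^ 2 * y k ^ 2) ν :=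
      integrable_finsetSum _ fun k _ => by
        simp_rw [pow_two (_ : ℝ)]
        exact (integrable_second H.sphere k k).const_mul _
    have iR : Integrable (fun y => (inner ℝ y x) ^ 2) ν := H.integrable_inner_sq hx
    have hle : ∫ y, (∫ z, binghamKernel z x * binghamKernel z y ∂ν) ^ 2 ∂ν
        ≤ ∫ y, (48 * r ^ 2 * ∑ k, x k ^ 2 * y k ^ 2 + 48 * r ^ 4 * (inner ℝ y x) ^ 2
          + 12 * r ^ 4) ∂ν := by
      refine integral_mono_of_nonneg (ae_of_all _ fun _ => sq_nonneg _)
        (((iQ.const_mul _).fun_add (iR.const_mul _)).add (integrable_const _))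
        (H.sphere.mono fun y hy => ?_)
      show (∫ z, binghamKernel z x * binghamKernel z y ∂ν) ^ 2 ≤ _
      rw [H.integral_binghamKernel_mul hx hy, real_inner_comm y x]
      have hQ1 : ∑ k, x k ^ 2 * y k ^ 2 ≤ 1 := sum_sq_mul_sq_le_one hx hy
      have hQ0 : 0 ≤ ∑ k, x k ^ 2 * y k ^ 2 := Finset.sum_nonneg fun k _ => by positivity
      have hR1 := inner_sq_le_one hy hx
      have hR0 := sq_nonneg (inner ℝ y x)
      set Q := ∑ k, x k ^ 2 * y k ^ 2
      set R := (inner ℝ y x) ^ 2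
      have b1 : (m₄ - 3 * m₂₂) ^ 2 ≤ 16 * r ^ 2 := by
        rw [show 16 * r ^ 2 = (4 * r) ^ 2 by ring]
        refine sq_le_sq' ?_ ?_ <;> nlinarith
      have b2 : (2 * m₂₂) ^ 2 ≤ 16 * r ^ 4 := by
        rw [show 16 * r ^ 4 = (4 * r ^ 2) ^ 2 by ring]
        exact pow_le_pow_left₀ (by linarith) (by linarith) 2
      have b3 : (m₂₂ - r ^ 2) ^ 2 ≤ 4 * r ^ 4 := by
        rw [show 4 * r ^ 4 = (2 * r ^ 2) ^ 2 by ring]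
        refine sq_le_sq' ?_ ?_ <;> nlinarith
      have c1 : ((m₄ - 3 * m₂₂) * Q) ^ 2 ≤ 16 * r ^ 2 * Q := by
        rw [mul_pow]
        exact mul_le_mul b1 (by nlinarith) (sq_nonneg _) (by positivity)
      have c2 : (2 * m₂₂ * R) ^ 2 ≤ 16 * r ^ 4 * R := by
        rw [mul_pow]
        exact mul_le_mul b2 (by nlinarith) (sq_nonneg _) (by positivity)
      -- This is `(a + b + c)² ≤ 3 (a² + b² + c²)`; the coefficients `48 + 48 + 12` add up to `108`.
      nlinarith [sq_nonneg ((m₄ - 3 * m₂₂) * Q - 2 * m₂₂ * R),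
        sq_nonneg (2 * m₂₂ * R - (m₂₂ - r ^ 2)), sq_nonneg ((m₄ - 3 * m₂₂) * Q - (m₂₂ - r ^ 2))]
    refine hle.trans ?_
    rw [integral_add ((iQ.const_mul _).fun_add (iR.const_mul _)) (integrable_const _),
      integral_add (iQ.const_mul _) (iR.const_mul _), integral_const_mul, integral_const_mul,
      H.integral_sum_sq_mul_sq hx, H.integral_inner_sq, hx, ← hr]
    simp only [integral_const, probReal_univ, one_smul]
    have e3 : 0 ≤ r ^ 3 := by positivity
    have e4 : r ^ 4 ≤ r ^ 3 := by nlinarith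
    have e5 : r ^ 5 ≤ r ^ 3 := by nlinarith [mul_nonneg h7 (sub_nonneg.2 e4)]
    nlinarith
  have := integral_mono_of_nonneg (μ := ν) (ae_of_all _ fun x => integral_nonneg fun y => sq_nonneg
    (∫ z, binghamKernel z x * binghamKernel z y ∂ν)) (integrable_const (108 * r ^ 3))
    (H.sphere.mono fun x h => hx x h)
  simpa using this

lemma degenerateKernel_binghamKernel (hp : 2 ≤ p) :
    DegenerateKernel ν binghamKernel (4 * (p : ℝ)⁻¹) (108 * ((p : ℝ)⁻¹) ^ 3) where
  measurable := measurable_binghamKernel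
  abs_le_one := abs_binghamKernel_le_one
  symm := binghamKernel_symm
  integral_eq_zero := H.integral_binghamKernel
  integral_sq_le := H.integral_binghamKernel_sq_le hp
  integral_iterate_sq_le := H.integral_binghamKernel_iterate_sq_le hp

lemma integral_integral_binghamKernel_sq :
    ∫ z, ∫ x, binghamKernel z x ^ 2 ∂ν ∂ν
      = (m₄ - 3 * m₂₂) * (p * m₄) + 3 * m₂₂ - ((p : ℝ)⁻¹) ^ 2 := by
  have e : ∀ᵐ z ∂ν, ∫ x, binghamKernel z x ^ 2 ∂ν
      = (m₄ - 3 * m₂₂) * ∑ k, z k * z k * (z k * z k) + (3 * m₂₂ - ((p : ℝ)⁻¹) ^ 2) :=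
      H.sphere.mono fun z hz => by
    simp_rw [binghamKernel_symm z, pow_two (binghamKernel _ _)]
    rw [H.integral_binghamKernel_mul hz hz, real_inner_self_eq_norm_sq, hz]
    simp_rw [pow_two]
    ring
  have i := fun k => integrable_fourth H.sphere k k k k
  rw [integral_congr_ae e, integral_add ((integrable_finsetSum _ fun k _ => i k).const_mul _)
    (integrable_const _), integral_const_mul, integral_finsetSum _ fun k _ => i k]
  simp_rw [H.fourth]
  simp
  ring

end HasSphericalMoments

end BinghamKernel

/-! ### Regularly varying tails and a Potter bound. -/

section Tail

variable (μ : Measure ℝ) [IsProbabilityMeasure μ]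

/-- The two-sided tail `x ↦ μ {y | x ≤ |y|}` of a law on the line. -/
noncomputable def absTail (x : ℝ) : ℝ := μ.real {y : ℝ | x ≤ |y|}

omit [IsProbabilityMeasure μ] in
lemma absTail_nonneg (x : ℝ) : 0 ≤ absTail μ x := measureReal_nonneg

lemma absTail_le_one (x : ℝ) : absTail μ x ≤ 1 := measureReal_le_one

lemma antitone_absTail : Antitone (absTail μ) := fun x y hxy =>
  measureReal_mono fun _ hz => le_trans hxy hz

variable {μ} {α : ℝ}

omit [IsProbabilityMeasure μ] in
lemma RegularlyVarying.tendsto_absTail_div (h : RegularlyVarying α μ) {a : ℝ} (ha : 0 < a) :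
    Tendsto (fun t => absTail μ (a * t) / absTail μ t) atTop (𝓝 (a ^ (-α))) := by
  obtain ⟨L, hL, hE⟩ := h
  obtain ⟨u, hu, he⟩ := hE.exists_eq_mul
  have hat : Tendsto (fun t : ℝ => a * t) atTop atTop := tendsto_id.const_mul_atTop ha
  have h1 : Tendsto (fun t => u (a * t) / u t * (L (a * t) / L t) * a ^ (-α)) atTop
      (𝓝 (1 / 1 * 1 * a ^ (-α))) :=
    (((hu.comp hat).div hu one_ne_zero).mul (hL a ha)).mul_const _
  rw [div_one, one_mul, one_mul] at h1
  refine h1.congr' ?_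
  filter_upwards [he, hat.eventually he, eventually_gt_atTop 0] with t h2 h3 ht
  have ht' : t ^ (-α) ≠ 0 := (Real.rpow_pos_of_pos ht _).ne'
  unfold absTail
  rw [h2, h3, Pi.mul_apply, Pi.mul_apply, Real.mul_rpow ha.le ht.le]
  rw [show u (a * t) * (L (a * t) * (a ^ (-α) * t ^ (-α)))
    = (u (a * t) * L (a * t) * a ^ (-α)) * t ^ (-α) by ring,
    show u t * (L t * t ^ (-α)) = (u t * L t) * t ^ (-α) by ring, mul_div_mul_right _ _ ht',
    mul_div_right_comm, mul_div_mul_comm]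

/-- If the tail vanished somewhere it would vanish beyond, and the ratio at `a = 1` would eventually
be `0 / 0 = 0` instead of tending to `1`. -/
lemma RegularlyVarying.absTail_pos (h : RegularlyVarying α μ) (x : ℝ) : 0 < absTail μ x := by
  refine lt_of_le_of_ne (absTail_nonneg μ x) fun h0 => ?_
  have h1 := h.tendsto_absTail_div one_pos
  have h2 : (fun t => absTail μ (1 * t) / absTail μ t) =ᶠ[atTop] fun _ => (0 : ℝ) := by
    filter_upwards [eventually_ge_atTop x] with t ht
    have : absTail μ t = 0 :=
      le_antisymm ((antitone_absTail μ ht).trans h0.ge) (absTail_nonneg μ t)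
    simp [this]
  have h3 := tendsto_nhds_unique (tendsto_const_nhds.congr' h2.symm) h1
  simp at h3

/-- A Potter bound for the ratio of two values of the tail. -/
lemma RegularlyVarying.exists_absTail_le (h : RegularlyVarying α μ) (hα : 0 < α) {b : ℝ}
    (hb : α < b) :
    ∃ x₀ C : ℝ, 0 < x₀ ∧ ∀ t, x₀ ≤ t → ∀ r, 0 < r →
      absTail μ (r * t) ≤ (C * r ^ (-b) + 1) * absTail μ t ∧ 0 ≤ C := by
  have hlim := h.tendsto_absTail_div (a := 2) two_pos
  -- The gap between `α` and `b` yields, beyond some `x₀`, a loss of at most `2 ^ b` per doubling;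
  -- the bound follows by iterating doublings.
  have hlt : (2 : ℝ) ^ (-b) < 2 ^ (-α) := Real.rpow_lt_rpow_of_exponent_lt one_lt_two (by linarith)
  obtain ⟨x₁, hx₁⟩ := eventually_atTop.1 (hlim.eventually (lt_mem_nhds hlt))
  set x₀ := max x₁ 1 with hx₀
  have hx0 : 0 < x₀ := lt_of_lt_of_le one_pos (le_max_right _ _)
  have hb0 : 0 < b := hα.trans hb
  have step : ∀ x, x₀ ≤ x → absTail μ x ≤ 2 ^ b * absTail μ (2 * x) := fun x hx => by
    have := hx₁ x ((le_max_left _ _).trans hx)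
    rw [lt_div_iff₀ (h.absTail_pos x), Real.rpow_neg two_pos.le, inv_mul_lt_iff₀ (by positivity)]
      at this
    exact this.le
  have iter : ∀ k : ℕ, ∀ x, x₀ ≤ x → absTail μ x ≤ (2 ^ b) ^ k * absTail μ (2 ^ k * x) := by
    intro k
    induction k with
    | zero => intro x _; simp
    | succ k ih =>
      intro x hx
      refine (ih x hx).trans ?_
      have h2 : x₀ ≤ 2 ^ k * x :=
        hx.trans (le_mul_of_one_le_left (hx0.le.trans hx) (one_le_pow₀ one_le_two))
      have := step _ h2
      rw [← mul_assoc, ← pow_succ'] at this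
      calc (2 ^ b) ^ k * absTail μ (2 ^ k * x)
          ≤ (2 ^ b) ^ k * (2 ^ b * absTail μ (2 ^ (k + 1) * x)) := by gcongr
        _ = _ := by ring
  have near : ∀ t r, 0 < r → r ≤ 1 → x₀ ≤ r * t →
      absTail μ (r * t) ≤ 2 ^ b * r ^ (-b) * absTail μ t := by
    intro t r hr hr1 hrt
    -- With `2ⁿ ≤ 1/r < 2ⁿ⁺¹`, `n + 1` doublings carry `r t` past `t`; the last one costs the extra
    -- factor `2 ^ b`.
    obtain ⟨n, hn1, hn2⟩ := exists_nat_pow_near (one_le_inv_iff₀.2 ⟨hr, hr1⟩)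
      (one_lt_two : (1 : ℝ) < 2)
    have ht : 0 < t := pos_of_mul_pos_right (hx0.trans_le hrt) hr.le
    refine (iter (n + 1) _ hrt).trans ?_
    have h1 : absTail μ (2 ^ (n + 1) * (r * t)) ≤ absTail μ t := by
      refine antitone_absTail μ ?_
      rw [← mul_assoc]
      refine le_mul_of_one_le_left ht.le ?_
      rw [← inv_mul_le_iff₀' hr, mul_one]
      exact hn2.le
    have h2 : ((2 : ℝ) ^ b) ^ (n + 1) ≤ 2 ^ b * r ^ (-b) := by
      rw [pow_succ', Real.rpow_neg hr.le, ← Real.inv_rpow hr.le, ← Real.rpow_natCast,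
        ← Real.rpow_mul two_pos.le, mul_comm b, Real.rpow_mul two_pos.le, Real.rpow_natCast]
      gcongr
    exact mul_le_mul h2 h1 (absTail_nonneg _ _) (by positivity)
  -- Dividing by the tail at `x₀` covers `r t < x₀`: there the tail is bounded by `1` and the
  -- comparison is made at `x₀ / t` in place of `r`. The summand `1` in the bound covers `r ≥ 1`.
  refine ⟨x₀, 2 ^ b / absTail μ x₀, hx0, fun t ht r hr =>
    ⟨?_, div_nonneg (by positivity) (absTail_nonneg _ _)⟩⟩
  have hH0 := h.absTail_pos x₀
  have hHt := h.absTail_pos t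
  have ht0 : 0 < t := hx0.trans_le ht
  have hrb : 0 < r ^ (-b) := Real.rpow_pos_of_pos hr _
  have hC : (2 : ℝ) ^ b ≤ 2 ^ b / absTail μ x₀ :=
    le_div_self (by positivity) hH0 (absTail_le_one μ x₀)
  have hmain : absTail μ (r * t) ≤ 2 ^ b / absTail μ x₀ * r ^ (-b) * absTail μ t
      ∨ absTail μ (r * t) ≤ absTail μ t := by
    rcases le_total 1 r with hr1 | hr1
    · exact Or.inr (antitone_absTail μ (le_mul_of_one_le_left ht0.le hr1))
    left
    rcases le_total x₀ (r * t) with hrt | hrt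
    · refine (near t r hr hr1 hrt).trans ?_
      gcongr
    · have h1 := near t (x₀ / t) (by positivity) ((div_le_one ht0).2 ht)
        (by rw [div_mul_cancel₀ _ ht0.ne'])
      rw [div_mul_cancel₀ _ ht0.ne'] at h1
      have h2 : (x₀ / t) ^ (-b) ≤ r ^ (-b) :=
        Real.rpow_le_rpow_of_nonpos hr ((le_div_iff₀ ht0).2 hrt) (by linarith)
      refine (absTail_le_one μ _).trans ?_
      rw [div_mul_eq_mul_div, div_mul_eq_mul_div, one_le_div hH0]
      refine h1.trans ?_
      gcongr
  rw [add_mul, one_mul]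
  rcases hmain with h1 | h1
  · linarith
  · have : 0 ≤ 2 ^ b / absTail μ x₀ * r ^ (-b) * absTail μ t := by positivity
    linarith

end Tail

/-! ### Karamata's theorem for Gaussian weights. -/

section Karamata

variable {μ : Measure ℝ} [IsProbabilityMeasure μ] {α : ℝ}

lemma integrableOn_pow_mul_exp_neg_sq (m : ℕ) :
    IntegrableOn (fun r : ℝ => r ^ m * Real.exp (-r ^ 2)) (Set.Ioi 0) := by
  have := integrableOn_rpow_mul_exp_neg_mul_sq (b := 1) one_pos (s := m)
    (by have : (0 : ℝ) ≤ m := m.cast_nonneg; linarith)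
  simpa using this

/-- The Abelian half of Karamata's theorem for the weights `rᵐ exp (-r²)`. -/
lemma RegularlyVarying.tendsto_integral_absTail (h : RegularlyVarying α μ) (hα : 0 < α)
    (hα2 : α < 2) {m : ℕ} (hm : 1 ≤ m) :
    Tendsto (fun t => (∫ r in Set.Ioi 0, r ^ m * Real.exp (-r ^ 2) * absTail μ (r * t))
      / absTail μ t) atTop (𝓝 (1 / 2 * Real.Gamma ((m + 1 - α) / 2))) := by
  have hm' : (1 : ℝ) ≤ m := by exact_mod_cast hm
  -- An exponent strictly between `α` and `2`: above `α` for the Potter bound, below `2` so that `r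
  -- ^ (m - b)` is integrable at `0` for every `m ≥ 1`.
  have hb : α < (α + 2) / 2 := by linarith
  obtain ⟨x₀, C, hx₀, hC⟩ := h.exists_absTail_le hα hb
  have hgamma : ∫ r in Set.Ioi (0 : ℝ), r ^ m * Real.exp (-r ^ 2) * r ^ (-α)
      = 1 / 2 * Real.Gamma ((m + 1 - α) / 2) := by
    have := integral_rpow_mul_exp_neg_rpow (p := 2) (q := m - α) two_pos (by linarith)
    rw [show (m : ℝ) - α + 1 = m + 1 - α by ring] at this
    rw [← this]
    refine setIntegral_congr_fun measurableSet_Ioi fun r (hr : 0 < r) => ?_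
    simp only [Real.rpow_two]
    rw [sub_eq_add_neg, Real.rpow_add hr, Real.rpow_natCast]
    ring
  rw [← hgamma]
  simp_rw [← integral_div]
  refine tendsto_integral_filter_of_dominated_convergence
    (fun r => r ^ m * Real.exp (-r ^ 2) * (C * r ^ (-((α + 2) / 2)) + 1)) ?_ ?_ ?_ ?_
  · refine Eventually.of_forall fun t => Measurable.aestronglyMeasurable ?_
    have : Measurable fun r => absTail μ (r * t) :=
      (antitone_absTail μ).measurable.comp (measurable_id.mul_const t)
    fun_prop
  · filter_upwards [eventually_ge_atTop x₀] with t ht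
    filter_upwards [ae_restrict_mem measurableSet_Ioi] with r hr
    have hr : 0 < r := hr
    have h1 := (hC t ht r hr).1
    have h0 := absTail_nonneg μ (r * t)
    have hp := h.absTail_pos t
    rw [Real.norm_of_nonneg (by positivity), mul_div_assoc]
    gcongr
    exact (div_le_iff₀ hp).2 h1
  · have h1 := (integrableOn_rpow_mul_exp_neg_mul_sq (b := 1) one_pos
      (s := m - (α + 2) / 2) (by linarith)).const_mul C
    refine (h1.add (integrableOn_pow_mul_exp_neg_sq m)).congr ?_
    filter_upwards [ae_restrict_mem measurableSet_Ioi] with r hr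
    have hr : 0 < r := hr
    simp only [Pi.add_apply]
    rw [sub_eq_add_neg, Real.rpow_add hr, Real.rpow_natCast, neg_one_mul]
    ring
  · filter_upwards [ae_restrict_mem measurableSet_Ioi] with r hr
    have := (h.tendsto_absTail_div (a := r) hr).const_mul (r ^ m * Real.exp (-r ^ 2))
    simpa only [mul_div_assoc] using this

lemma integrableOn_mul_absTail {g : ℝ → ℝ} (hg : IntegrableOn g (Set.Ioi 0)) (t : ℝ) :
    IntegrableOn (fun r => g r * absTail μ (r * t)) (Set.Ioi 0) := by
  refine hg.mul_bdd (c := 1) ?_ (ae_of_all _ fun r => ?_)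
  · exact ((antitone_absTail μ).measurable.comp (measurable_id.mul_const t)).aestronglyMeasurable
  · rw [Real.norm_of_nonneg (absTail_nonneg μ _)]
    exact absTail_le_one μ _

/-- Integration by parts against the tail. -/
lemma integral_comp_abs_div_eq {G g : ℝ → ℝ} (hG0 : G 0 = 0) (hG : ∀ x, HasDerivAt G (g x) x)
    (hgc : Continuous g) (hg : IntegrableOn g (Set.Ioi 0)) {t : ℝ} (ht : 0 < t) :
    ∫ y, G (|y| / t) ∂μ = ∫ r in Set.Ioi 0, g r * absTail μ (r * t) := by
  have hS : MeasurableSet {q : ℝ × ℝ | q.2 * t ≤ |q.1|} :=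
    measurableSet_le (by fun_prop) (by fun_prop)
  have e1 : ∀ y : ℝ, G (|y| / t)
      -- Layer-cake form: `G (|y| / t)` is the integral of `g` over `r ≤ |y| / t`, and Fubini turns
      -- the `y`-integral of the indicator into the tail.
      = ∫ r in Set.Ioi 0, {q : ℝ × ℝ | q.2 * t ≤ |q.1|}.indicator (fun q => g q.2) (y, r) :=
      fun y => by
    have h1 : ∫ r in (0 : ℝ)..(|y| / t), g r = G (|y| / t) - G 0 :=
      intervalIntegral.integral_eq_sub_of_hasDerivAt (fun x _ => hG x)
        (hgc.intervalIntegrable _ _)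
    rw [hG0, sub_zero, intervalIntegral.integral_of_le (by positivity)] at h1
    have h2 : ∀ r, {q : ℝ × ℝ | q.2 * t ≤ |q.1|}.indicator (fun q => g q.2) (y, r)
        = (Set.Iic (|y| / t)).indicator g r := fun r => by
      simp only [Set.indicator, Set.mem_ofPred_eq, Set.mem_Iic, le_div_iff₀ ht]
    simp_rw [h2]
    rw [setIntegral_indicator measurableSet_Iic, Set.Ioi_inter_Iic, h1]
  simp_rw [e1]
  rw [integral_integral_swap]
  · refine setIntegral_congr_fun measurableSet_Ioi fun r _ => ?_
    have h2 : ∀ y, {q : ℝ × ℝ | q.2 * t ≤ |q.1|}.indicator (fun q => g q.2) (y, r)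
        = {y : ℝ | r * t ≤ |y|}.indicator (fun _ => g r) y := fun y => by
      simp only [Set.indicator, Set.mem_ofPred_eq]
    simp_rw [h2]
    rw [integral_indicator_const _ (measurableSet_le (by fun_prop) (by fun_prop)), smul_eq_mul,
      mul_comm]
    rfl
  · exact (Integrable.comp_snd hg μ).indicator hS

end Karamata

/-! ### Self-normalised sums as Laplace integrals. -/

section WeightedLaplace

variable (μ : Measure ℝ)

/-- The moment `E (s^n X^(2n+2) exp (-s X²))`. -/
noncomputable def laplaceMoment (n : ℕ) (s : ℝ) : ℝ :=
  ∫ y, s ^ n * y ^ (2 * n + 2) * Real.exp (-(s * y ^ 2)) ∂μ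

/-- The Laplace transform `E exp (-s X²)`. -/
noncomputable def sqLaplace (s : ℝ) : ℝ := ∫ y, Real.exp (-(s * y ^ 2)) ∂μ

variable {μ} [IsProbabilityMeasure μ]

omit [IsProbabilityMeasure μ] in
lemma sqLaplace_nonneg (s : ℝ) : 0 ≤ sqLaplace μ s := integral_nonneg fun _ => (Real.exp_pos _).le

omit [IsProbabilityMeasure μ] in
lemma laplaceMoment_nonneg (n : ℕ) {s : ℝ} (hs : 0 ≤ s) : 0 ≤ laplaceMoment μ n s :=
  integral_nonneg fun y => mul_nonneg (mul_nonneg (pow_nonneg hs _)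
    (Even.pow_nonneg ⟨n + 1, by ring⟩ _)) (Real.exp_pos _).le

lemma stronglyMeasurable_sqLaplace : StronglyMeasurable (sqLaplace μ) := by
  refine StronglyMeasurable.integral_prod_right
    (f := fun s y : ℝ => Real.exp (-(s * y ^ 2))) ?_
  exact Measurable.stronglyMeasurable (by unfold Function.uncurry; fun_prop)

lemma stronglyMeasurable_laplaceMoment (n : ℕ) : StronglyMeasurable (laplaceMoment μ n) := by
  refine StronglyMeasurable.integral_prod_right
    (f := fun s y : ℝ => s ^ n * y ^ (2 * n + 2) * Real.exp (-(s * y ^ 2))) ?_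
  exact Measurable.stronglyMeasurable (by unfold Function.uncurry; fun_prop)

lemma boundedMeasurable_exp_neg_mul_sq {s : ℝ} (hs : 0 ≤ s) :
    BoundedMeasurable (fun y : ℝ => Real.exp (-(s * y ^ 2))) := by
  refine ⟨by fun_prop, 1, fun y => ?_⟩
  rw [abs_of_pos (Real.exp_pos _)]
  exact Real.exp_le_one_iff.2 (neg_nonpos.2 (by positivity))

lemma antitoneOn_sqLaplace : AntitoneOn (sqLaplace μ) (Set.Ici 0) := fun _ ha _ hb hab =>
  integral_mono ((boundedMeasurable_exp_neg_mul_sq hb).integrable μ)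
    ((boundedMeasurable_exp_neg_mul_sq ha).integrable μ) fun y => Real.exp_le_exp.2
      (neg_le_neg (mul_le_mul_of_nonneg_right hab (sq_nonneg y)))

lemma sqLaplace_le_one {s : ℝ} (hs : 0 ≤ s) : sqLaplace μ s ≤ 1 := by
  have := antitoneOn_sqLaplace (μ := μ) Set.self_mem_Ici hs hs
  simpa [sqLaplace] using this

lemma sqLaplace_lt_one (h0 : μ {0} = 0) {s : ℝ} (hs : 0 < s) : sqLaplace μ s < 1 := by
  refine lt_of_le_of_ne (sqLaplace_le_one hs.le) fun h1 => ?_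
  have hb := boundedMeasurable_exp_neg_mul_sq hs.le
  have h2 : ∫ y, (1 - Real.exp (-(s * y ^ 2))) ∂μ = 0 := by
    rw [integral_sub (integrable_const _) (hb.integrable μ)]
    simp only [integral_const, probReal_univ, one_smul]
    exact sub_eq_zero.2 h1.symm
  rw [integral_eq_zero_iff_of_nonneg (fun y => sub_nonneg.2 (Real.exp_le_one_iff.2
    (neg_nonpos.2 (by positivity)))) ((BoundedMeasurable.const 1).sub hb |>.integrable μ)] at h2
  have h3 : ∀ᵐ y ∂μ, y = 0 := h2.mono fun y hy => by
    have : Real.exp (-(s * y ^ 2)) = 1 := (sub_eq_zero.1 hy).symm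
    rw [Real.exp_eq_one_iff, neg_eq_zero, mul_eq_zero] at this
    exact pow_eq_zero_iff two_ne_zero |>.1 (this.resolve_left hs.ne')
  have h4 : ∀ᵐ y ∂μ, y ≠ 0 := by
    rw [ae_iff]
    simpa using h0
  have h5 : ∀ᵐ y ∂μ, False := by
    filter_upwards [h3, h4] with y h h' using h' h
  exact IsProbabilityMeasure.ne_zero μ (by simpa using h5)

/-- The exponential factorises over coordinates, so independence leaves one weighted factor and `p -
1` Laplace transforms. -/
lemma integral_pi_sum_mul_exp (p : ℕ) (s : ℝ) (u : ℝ → ℝ) :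
    ∀ k, ∫ x : Fin p → ℝ, u (x k) * Real.exp (-(s * ∑ i, x i ^ 2)) ∂(Measure.pi fun _ => μ)
      = (∫ y, u y * Real.exp (-(s * y ^ 2)) ∂μ) * sqLaplace μ s ^ (p - 1) := fun k => by
  have e : ∀ x : Fin p → ℝ, u (x k) * Real.exp (-(s * ∑ i, x i ^ 2))
      = ∏ i, (if i = k then u (x i) * Real.exp (-(s * x i ^ 2)) else Real.exp (-(s * x i ^ 2))) :=
      fun x => by
    rw [← Finset.mul_prod_erase _ _ (Finset.mem_univ k), if_pos rfl,
      Finset.prod_congr rfl fun i hi => if_neg (Finset.ne_of_mem_erase hi), mul_assoc,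
      Finset.mul_prod_erase _ (fun i => Real.exp (-(s * x i ^ 2))) (Finset.mem_univ k),
      ← Real.exp_sum, Finset.mul_sum, Finset.sum_neg_distrib]
  simp_rw [e]
  rw [integral_fintype_prod_eq_prod (fun i y => if i = k then u y * Real.exp (-(s * y ^ 2))
      else Real.exp (-(s * y ^ 2))), ← Finset.mul_prod_erase _ _ (Finset.mem_univ k)]
  congr 1
  · simp
  · rw [Finset.prod_congr rfl fun i hi => by
      simp only [if_neg (Finset.ne_of_mem_erase hi)]
      exact (rfl : _ = sqLaplace μ s)]
    simp [Finset.card_erase_of_mem]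

lemma boundedMeasurable_laplaceMoment (n : ℕ) {s : ℝ} (hs : 0 < s) :
    BoundedMeasurable (fun y : ℝ => s ^ n * y ^ (2 * n + 2) * Real.exp (-(s * y ^ 2))) := by
  refine ⟨by fun_prop, (n + 1).factorial / s, fun y => ?_⟩
  have h := Real.pow_div_factorial_le_exp (s * y ^ 2) (by positivity) (n + 1)
  rw [div_le_iff₀ (by positivity)] at h
  have hy : 0 ≤ y ^ (2 * n + 2) := Even.pow_nonneg ⟨n + 1, by ring⟩ _
  beta_reduce
  rw [abs_of_nonneg (by positivity), le_div_iff₀ hs, Real.exp_neg, ← div_eq_mul_inv,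
    div_mul_eq_mul_div, div_le_iff₀ (Real.exp_pos _)]
  calc s ^ n * y ^ (2 * n + 2) * s = (s * y ^ 2) ^ (n + 1) := by ring
    _ ≤ _ := by linarith

lemma lintegral_pow_mul_exp_neg_mul (n : ℕ) {T : ℝ} (hT : 0 < T) :
    ∫⁻ s in Set.Ioi 0, ENNReal.ofReal (s ^ n * Real.exp (-(s * T)))
      = ENNReal.ofReal (n.factorial / T ^ (n + 1)) := by
  have h := Real.integral_rpow_mul_exp_neg_mul_Ioi (a := n + 1) (r := T) (by positivity) hT
  have e : ∀ s : ℝ, s ^ ((n : ℝ) + 1 - 1) * Real.exp (-(T * s)) = s ^ n * Real.exp (-(s * T)) :=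
    fun s => by rw [add_sub_cancel_right, Real.rpow_natCast, mul_comm T]
  simp_rw [e] at h
  rw [Real.Gamma_nat_eq_factorial, one_div,
    show ((n : ℝ) + 1) = ((n + 1 : ℕ) : ℝ) by push_cast; rfl, Real.rpow_natCast, inv_pow,
    inv_mul_eq_div] at h
  rw [← h, ofReal_integral_eq_lintegral_ofReal]
  · refine Integrable.of_integral_ne_zero ?_
    rw [h]
    positivity
  · filter_upwards [ae_restrict_mem measurableSet_Ioi] with s hs
    have : 0 < s := hs
    show 0 ≤ s ^ n * Real.exp (-(s * T))
    positivity

lemma ae_pi_sum_sq_pos (h0 : μ {0} = 0) {p : ℕ} (hp : 1 ≤ p) :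
    ∀ᵐ x : Fin p → ℝ ∂(Measure.pi fun _ => μ), 0 < ∑ i, x i ^ 2 := by
  have h4 : ∀ᵐ y ∂μ, y ≠ 0 := by
    rw [ae_iff]
    simpa using h0
  have h := (measurePreserving_eval (fun _ : Fin p => μ) ⟨0, hp⟩).quasiMeasurePreserving.ae h4
  filter_upwards [h] with x hx
  exact Finset.sum_pos' (fun i _ => sq_nonneg _) ⟨⟨0, hp⟩, Finset.mem_univ _, by positivity⟩

/-- Tonelli together with `∫ sⁿ e^{-sT} ds = n! / T^(n+1)`, where `T = ∑ x_i²` is almost surely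
positive because `μ` has no atom at `0`. Working with `∫⁻` lets the boundedness of the right side
yield integrability on the left. -/
lemma lintegral_laplaceMoment_mul (h0 : μ {0} = 0) {p : ℕ} (hp : 1 ≤ p) (n : ℕ) :
    ∫⁻ s in Set.Ioi 0, ENNReal.ofReal (p * (laplaceMoment μ n s * sqLaplace μ s ^ (p - 1)))
      = ∫⁻ x : Fin p → ℝ, ENNReal.ofReal ((∑ k, x k ^ (2 * n + 2)) * (n.factorial /
          (∑ i, x i ^ 2) ^ (n + 1))) ∂(Measure.pi fun _ => μ) := by
  have hpow : ∀ y : ℝ, 0 ≤ y ^ (2 * n + 2) := fun y => Even.pow_nonneg ⟨n + 1, by ring⟩ _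
  have inner_x : ∀ s ∈ Set.Ioi (0 : ℝ),
      ENNReal.ofReal (p * (laplaceMoment μ n s * sqLaplace μ s ^ (p - 1)))
      = ∫⁻ x : Fin p → ℝ, ENNReal.ofReal ((∑ k, x k ^ (2 * n + 2)) * (s ^ n *
          Real.exp (-(s * ∑ i, x i ^ 2)))) ∂(Measure.pi fun _ => μ) := fun s (hs : 0 < s) => by
    have hb : ∀ k : Fin p, BoundedMeasurable (fun x : Fin p → ℝ =>
        s ^ n * x k ^ (2 * n + 2) * Real.exp (-(s * ∑ i, x i ^ 2))) := fun k => by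
      refine ⟨by fun_prop, ?_⟩
      obtain ⟨-, C, hC⟩ := boundedMeasurable_laplaceMoment n hs
      refine ⟨C, fun x => le_trans ?_ (hC (x k))⟩
      have := hpow (x k)
      beta_reduce
      rw [abs_of_nonneg (by positivity), abs_of_nonneg (by positivity)]
      gcongr
      exact Finset.single_le_sum (f := fun i => x i ^ 2) (fun _ _ => sq_nonneg _)
        (Finset.mem_univ k)
    have e : ∀ x : Fin p → ℝ, (∑ k, x k ^ (2 * n + 2)) * (s ^ n *
        Real.exp (-(s * ∑ i, x i ^ 2)))
        = ∑ k, s ^ n * x k ^ (2 * n + 2) * Real.exp (-(s * ∑ i, x i ^ 2)) := fun x => by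
      rw [Finset.sum_mul]
      exact Finset.sum_congr rfl fun k _ => by ring
    simp_rw [e]
    rw [← ofReal_integral_eq_lintegral_ofReal
      ((BoundedMeasurable.sum fun k _ => hb k).integrable _) (ae_of_all _ fun x =>
        Finset.sum_nonneg fun k _ => by have := hpow (x k); positivity),
      integral_finsetSum _ fun k _ => (hb k).integrable _]
    simp_rw [integral_pi_sum_mul_exp p s (fun y => s ^ n * y ^ (2 * n + 2))]
    simp [laplaceMoment]
  rw [setLIntegral_congr_fun measurableSet_Ioi inner_x, lintegral_lintegral_swap]
  · refine lintegral_congr_ae ?_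
    filter_upwards [ae_pi_sum_sq_pos h0 hp] with x hx
    have hs : 0 ≤ ∑ k, x k ^ (2 * n + 2) := Finset.sum_nonneg fun k _ => hpow _
    simp_rw [ENNReal.ofReal_mul hs]
    rw [lintegral_const_mul _ (by fun_prop), lintegral_pow_mul_exp_neg_mul n hx]
  · exact Measurable.aemeasurable (by fun_prop)

lemma sum_pow_mul_div_nonneg {p : ℕ} (n : ℕ) (x : Fin p → ℝ) :
    0 ≤ (∑ k, x k ^ (2 * n + 2)) * (n.factorial / (∑ i, x i ^ 2) ^ (n + 1)) :=
  mul_nonneg (Finset.sum_nonneg fun k _ => Even.pow_nonneg ⟨n + 1, by ring⟩ _) (by positivity)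

lemma integral_laplaceMoment_mul (h0 : μ {0} = 0) {p : ℕ} (hp : 1 ≤ p) (n : ℕ) :
    ∫ s in Set.Ioi 0, p * (laplaceMoment μ n s * sqLaplace μ s ^ (p - 1))
      = ∫ x : Fin p → ℝ, (∑ k, x k ^ (2 * n + 2)) * (n.factorial /
          (∑ i, x i ^ 2) ^ (n + 1)) ∂(Measure.pi fun _ => μ) := by
  rw [integral_eq_lintegral_of_nonneg_ae, integral_eq_lintegral_of_nonneg_ae,
    lintegral_laplaceMoment_mul h0 hp]
  · exact ae_of_all _ fun x => sum_pow_mul_div_nonneg n x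
  · exact Measurable.aestronglyMeasurable (by fun_prop)
  · filter_upwards [ae_restrict_mem measurableSet_Ioi] with s hs
    exact mul_nonneg p.cast_nonneg (mul_nonneg (laplaceMoment_nonneg n (le_of_lt hs))
      (pow_nonneg (sqLaplace_nonneg s) _))
  · exact (((stronglyMeasurable_laplaceMoment n).mul (stronglyMeasurable_sqLaplace.pow
      (p - 1))).const_mul _).aestronglyMeasurable

lemma sum_pow_mul_div_le {p : ℕ} (n : ℕ) (x : Fin p → ℝ) :
    (∑ k, x k ^ (2 * n + 2)) * (n.factorial / (∑ i, x i ^ 2) ^ (n + 1)) ≤ n.factorial := by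
  have hT : 0 ≤ ∑ i, x i ^ 2 := Finset.sum_nonneg fun i _ => sq_nonneg _
  rw [mul_div_assoc', mul_comm]
  refine div_le_of_le_mul₀ (by positivity) (by positivity) ?_
  gcongr
  rw [pow_succ', Finset.sum_mul]
  refine Finset.sum_le_sum fun k _ => ?_
  rw [show x k ^ (2 * n + 2) = x k ^ 2 * (x k ^ 2) ^ n by ring]
  gcongr
  exact Finset.single_le_sum (f := fun i => x i ^ 2) (fun _ _ => sq_nonneg _) (Finset.mem_univ k)

lemma integrableOn_laplaceMoment_mul (h0 : μ {0} = 0) {p : ℕ} (hp : 1 ≤ p) (n : ℕ) :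
    IntegrableOn (fun s => p * (laplaceMoment μ n s * sqLaplace μ s ^ (p - 1))) (Set.Ioi 0) := by
  refine ⟨(((stronglyMeasurable_laplaceMoment n).mul (stronglyMeasurable_sqLaplace.pow
    (p - 1))).const_mul _).aestronglyMeasurable, ?_⟩
  rw [hasFiniteIntegral_iff_ofReal, lintegral_laplaceMoment_mul h0 hp]
  · refine (lintegral_mono (g := fun _ => ENNReal.ofReal n.factorial) fun x =>
      ENNReal.ofReal_le_ofReal (sum_pow_mul_div_le n x)).trans_lt ?_
    simp
  · filter_upwards [ae_restrict_mem measurableSet_Ioi] with s hs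
    exact mul_nonneg p.cast_nonneg (mul_nonneg (laplaceMoment_nonneg n (le_of_lt hs))
      (pow_nonneg (sqLaplace_nonneg s) _))

lemma integral_laplaceMoment_zero_mul (h0 : μ {0} = 0) {p : ℕ} (hp : 1 ≤ p) :
    ∫ s in Set.Ioi 0, p * (laplaceMoment μ 0 s * sqLaplace μ s ^ (p - 1)) = 1 := by
  rw [integral_laplaceMoment_mul h0 hp]
  have : ∀ᵐ x : Fin p → ℝ ∂(Measure.pi fun _ => μ), (∑ k, x k ^ (2 * 0 + 2)) *
      (Nat.factorial 0 / (∑ i, x i ^ 2) ^ (0 + 1)) = 1 :=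
    (ae_pi_sum_sq_pos h0 hp).mono fun x hx => by
      simp [hx.ne']
  rw [integral_congr_ae this]
  simp

lemma integral_laplaceMoment_one_mul (h0 : μ {0} = 0) {p : ℕ} (hp : 1 ≤ p) :
    ∫ s in Set.Ioi 0, p * (laplaceMoment μ 1 s * sqLaplace μ s ^ (p - 1))
      = ∫ x : Fin p → ℝ, ∑ k, sphereProj x k ^ 4 ∂(Measure.pi fun _ => μ) := by
  rw [integral_laplaceMoment_mul h0 hp]
  congr with x
  have hT : 0 ≤ ∑ i, x i ^ 2 := Finset.sum_nonneg fun i _ => sq_nonneg _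
  simp only [sphereProj_apply, div_pow]
  rw [← Finset.sum_div, show √(∑ i, x i ^ 2) ^ 4 = (√(∑ i, x i ^ 2) ^ 2) ^ 2 by ring,
    Real.sq_sqrt hT]
  simp [div_eq_mul_inv]

end WeightedLaplace

/-! ### The limit of the self-normalised fourth moment. -/

section SelfNormalized

variable {μ : Measure ℝ} [IsProbabilityMeasure μ] {α : ℝ}

lemma integral_comp_abs_div_pow_exp (n : ℕ) {t : ℝ} (ht : 0 < t) :
    ∫ y, (|y| / t) ^ (2 * n + 2) * Real.exp (-(|y| / t) ^ 2) ∂μ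
      = (2 * n + 2) * (∫ r in Set.Ioi 0, r ^ (2 * n + 1) * Real.exp (-r ^ 2) * absTail μ (r * t))
        - 2 * ∫ r in Set.Ioi 0, r ^ (2 * n + 3) * Real.exp (-r ^ 2) * absTail μ (r * t) := by
  have h1 := integrableOn_pow_mul_exp_neg_sq (2 * n + 1)
  have h3 := integrableOn_pow_mul_exp_neg_sq (2 * n + 3)
  rw [integral_comp_abs_div_eq (G := fun x => x ^ (2 * n + 2) * Real.exp (-x ^ 2))
    (g := fun x => (2 * n + 2) * (x ^ (2 * n + 1) * Real.exp (-x ^ 2))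
      - 2 * (x ^ (2 * n + 3) * Real.exp (-x ^ 2))) (by simp) (fun x => ?_) (by fun_prop)
    ((h1.const_mul _).sub (h3.const_mul _)) ht, ← integral_const_mul, ← integral_const_mul,
    ← integral_sub ((integrableOn_mul_absTail h1 t).const_mul _)
      ((integrableOn_mul_absTail h3 t).const_mul _)]
  · congr with r
    ring
  · have hd := (hasDerivAt_pow (2 * n + 2) x).mul ((hasDerivAt_pow 2 x).neg.exp)
    refine hd.congr_deriv ?_
    simp only [Pi.neg_apply, Nat.add_one_sub_one]
    push_cast
    ring

omit [IsProbabilityMeasure μ] in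
lemma laplaceMoment_inv_sq (n : ℕ) {t : ℝ} (ht : 0 < t) :
    laplaceMoment μ n (t ^ 2)⁻¹ = t ^ 2 *
      ∫ y, (|y| / t) ^ (2 * n + 2) * Real.exp (-(|y| / t) ^ 2) ∂μ := by
  rw [laplaceMoment, ← integral_const_mul]
  congr with y
  rw [div_pow |y| t 2, sq_abs, div_pow, show 2 * n + 2 = 2 * (n + 1) by ring, pow_mul |y|, sq_abs,
    pow_mul t, pow_mul y, pow_succ (t ^ 2) n, inv_pow, ← div_eq_inv_mul (y ^ 2)]
  field_simp

/-- Integration by parts against the tail gives two Karamata integrals, whose limits combine as `(n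
+ 1) Γ(z) - Γ(z + 1) = (α/2) Γ(z)` at `z = n + 1 - α/2`. -/
lemma RegularlyVarying.tendsto_laplaceMoment (h : RegularlyVarying α μ) (hα : 0 < α)
    (hα2 : α < 2) (n : ℕ) :
    Tendsto (fun t => laplaceMoment μ n (t ^ 2)⁻¹ / (t ^ 2 * absTail μ t)) atTop
      (𝓝 (α / 2 * Real.Gamma (n + 1 - α / 2))) := by
  have h1 := (h.tendsto_integral_absTail hα hα2 (m := 2 * n + 1) (by omega)).const_mul
    (2 * (n : ℝ) + 2)
  have h3 := (h.tendsto_integral_absTail hα hα2 (m := 2 * n + 3) (by omega)).const_mul 2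
  have hG : (2 * (n : ℝ) + 2) * (1 / 2 * Real.Gamma ((((2 * n + 1 : ℕ) : ℝ) + 1 - α) / 2))
      - 2 * (1 / 2 * Real.Gamma ((((2 * n + 3 : ℕ) : ℝ) + 1 - α) / 2))
      = α / 2 * Real.Gamma (n + 1 - α / 2) := by
    have hn : (0 : ℝ) ≤ n := n.cast_nonneg
    have e1 : (((2 * n + 1 : ℕ) : ℝ) + 1 - α) / 2 = n + 1 - α / 2 := by
      push_cast
      ring
    have e2 : (((2 * n + 3 : ℕ) : ℝ) + 1 - α) / 2 = (n + 1 - α / 2) + 1 := by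
      push_cast
      ring
    rw [e1, e2, Real.Gamma_add_one (by linarith)]
    ring
  have h5 := h1.sub h3
  rw [hG] at h5
  refine h5.congr' ?_
  filter_upwards [eventually_gt_atTop 0] with t ht
  have hp := h.absTail_pos t
  rw [laplaceMoment_inv_sq n ht, integral_comp_abs_div_pow_exp n ht,
    mul_div_mul_left _ _ (by positivity)]
  ring

lemma RegularlyVarying.tendsto_laplaceMoment_ratio (h : RegularlyVarying α μ) (hα : 0 < α)
    (hα2 : α < 2) :
    Tendsto (fun s => laplaceMoment μ 1 s / laplaceMoment μ 0 s) (𝓝[>] 0) (𝓝 (1 - α / 2)) := by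
  have hG : 0 < Real.Gamma (1 - α / 2) := Real.Gamma_pos_of_pos (by linarith)
  have h0 := h.tendsto_laplaceMoment hα hα2 0
  have h1 := h.tendsto_laplaceMoment hα hα2 1
  have h2 := h1.div h0 (by
    simp only [Nat.cast_zero, zero_add]
    positivity)
  have e : α / 2 * Real.Gamma (((1 : ℕ) : ℝ) + 1 - α / 2)
      / (α / 2 * Real.Gamma (((0 : ℕ) : ℝ) + 1 - α / 2)) = 1 - α / 2 := by
    rw [Nat.cast_one, Nat.cast_zero, zero_add,
      show (1 : ℝ) + 1 - α / 2 = (1 - α / 2) + 1 by ring, Real.Gamma_add_one (by linarith),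
      mul_div_mul_left _ _ (by positivity), mul_div_cancel_right₀ _ hG.ne']
  rw [e] at h2
  have ht : Tendsto (fun s : ℝ => √(s⁻¹)) (𝓝[>] 0) atTop :=
    Real.tendsto_sqrt_atTop.comp tendsto_inv_nhdsGT_zero
  refine (h2.comp ht).congr' ?_
  filter_upwards [self_mem_nhdsWithin] with s hs
  have hs : 0 < s := hs
  have hp := h.absTail_pos √(s⁻¹)
  have hs' : 0 < s⁻¹ := by positivity
  simp only [Function.comp_apply, Pi.div_apply, Real.sq_sqrt hs'.le, inv_inv]
  rw [div_div_div_cancel_right₀ (by positivity)]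

lemma RegularlyVarying.exists_abs_laplaceMoment_sub_le (h : RegularlyVarying α μ) (hα : 0 < α)
    (hα2 : α < 2) {ε : ℝ} (hε : 0 < ε) :
    ∃ δ : ℝ, 0 < δ ∧ ∀ s, 0 < s → s < δ →
      |laplaceMoment μ 1 s - (1 - α / 2) * laplaceMoment μ 0 s| ≤ ε * laplaceMoment μ 0 s := by
  -- Capping the radius at `1 - α/2` excludes a zero denominator, since the ratio would then be `0`,
  -- at distance exactly `1 - α/2` from the limit.
  have h1 := (h.tendsto_laplaceMoment_ratio hα hα2).eventually
    ((Metric.ball_mem_nhds _ (lt_min hε (by linarith : 0 < 1 - α / 2))))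
  obtain ⟨δ, hδ, hδ'⟩ := mem_nhdsGT_iff_exists_Ioo_subset.1 h1
  refine ⟨δ, hδ, fun s hs hsδ => ?_⟩
  have h2 : laplaceMoment μ 1 s / laplaceMoment μ 0 s ∈ Metric.ball (1 - α / 2) _ := hδ' ⟨hs, hsδ⟩
  rw [Metric.mem_ball, Real.dist_eq, lt_min_iff] at h2
  have hA0 := laplaceMoment_nonneg (μ := μ) 0 hs.le
  have hA : laplaceMoment μ 0 s ≠ 0 := fun h0 => by
    rw [h0, div_zero, zero_sub, abs_neg, abs_of_pos (by linarith)] at h2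
    exact lt_irrefl _ h2.2
  have hA' : 0 < laplaceMoment μ 0 s := lt_of_le_of_ne hA0 hA.symm
  rw [show laplaceMoment μ 1 s - (1 - α / 2) * laplaceMoment μ 0 s
    = (laplaceMoment μ 1 s / laplaceMoment μ 0 s - (1 - α / 2)) * laplaceMoment μ 0 s by
      rw [sub_mul (_ / _), div_mul_cancel₀ _ hA], abs_mul, abs_of_pos hA']
  exact mul_le_mul_of_nonneg_right h2.1.le hA'.le

/-- The self-normalized sum of fourth powers converges in mean. -/
lemma RegularlyVarying.tendsto_integral_sum_sphereProj_pow_four (h : RegularlyVarying α μ)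
    (hα : 0 < α) (hα2 : α < 2) (h0 : μ {0} = 0) :
    Tendsto (fun p : ℕ => ∫ x : Fin p → ℝ, ∑ k, sphereProj x k ^ 4 ∂(Measure.pi fun _ => μ))
      atTop (𝓝 (1 - α / 2)) := by
  set c := 1 - α / 2 with hc
  have hc0 : 0 < c := by linarith
  have hc1 : c ≤ 1 := by linarith
  -- Below `δ` the two integrands are proportional up to `ε`, and the weight has total mass `1`;
  -- beyond `δ` the power of the Laplace transform is exponentially small in `p`.
  have hbound : ∀ ε > 0, ∃ δ > 0, ∀ p : ℕ, 2 ≤ p →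
      |(∫ x : Fin p → ℝ, ∑ k, sphereProj x k ^ 4 ∂(Measure.pi fun _ => μ)) - c|
        ≤ ε + p * sqLaplace μ δ ^ (p - 2) := by
    intro ε hε
    obtain ⟨δ, hδ, hδ'⟩ := h.exists_abs_laplaceMoment_sub_le hα hα2 hε
    refine ⟨δ, hδ, fun p hp => ?_⟩
    have i0 := integrableOn_laplaceMoment_mul h0 (by omega : 1 ≤ p) 0
    have i1 := integrableOn_laplaceMoment_mul h0 (by omega : 1 ≤ p) 1
    -- For `s ≥ δ`, all but one of the `p - 1` Laplace factors are bounded by their value at `δ`;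
    -- the remaining integrals are the case `p = 2`, of mass at most `1`.
    have j0 := integrableOn_laplaceMoment_mul h0 (by norm_num : 1 ≤ 2) 0
    have j1 := integrableOn_laplaceMoment_mul h0 (by norm_num : 1 ≤ 2) 1
    have e : (∫ x : Fin p → ℝ, ∑ k, sphereProj x k ^ 4 ∂(Measure.pi fun _ => μ)) - c
        = ∫ s in Set.Ioi 0, (p * (laplaceMoment μ 1 s * sqLaplace μ s ^ (p - 1))
          - c * (p * (laplaceMoment μ 0 s * sqLaplace μ s ^ (p - 1)))) := by
      rw [integral_sub i1 (i0.const_mul _), integral_const_mul c,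
        integral_laplaceMoment_zero_mul h0 (by omega), integral_laplaceMoment_one_mul h0 (by omega),
        mul_one]
    set d := p * sqLaplace μ δ ^ (p - 2) with hd
    have hd0 : 0 ≤ d := mul_nonneg p.cast_nonneg (pow_nonneg (sqLaplace_nonneg _) _)
    have hpt : ∀ s ∈ Set.Ioi (0 : ℝ), ‖p * (laplaceMoment μ 1 s * sqLaplace μ s ^ (p - 1))
          - c * (p * (laplaceMoment μ 0 s * sqLaplace μ s ^ (p - 1)))‖
        ≤ ε * (p * (laplaceMoment μ 0 s * sqLaplace μ s ^ (p - 1)))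
          + (d / 2 * (((2 : ℕ) : ℝ) * (laplaceMoment μ 1 s * sqLaplace μ s ^ (2 - 1)))
          + d / 2 * (((2 : ℕ) : ℝ) * (laplaceMoment μ 0 s * sqLaplace μ s ^ (2 - 1)))) := by
      intro s (hs : 0 < s)
      have hA := laplaceMoment_nonneg (μ := μ) 0 hs.le
      have hB := laplaceMoment_nonneg (μ := μ) 1 hs.le
      have hφ := sqLaplace_nonneg (μ := μ) s
      have hpow : sqLaplace μ s ^ (p - 1) = sqLaplace μ s ^ (p - 2) * sqLaplace μ s := by
        rw [← pow_succ]
        congr 1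
        omega
      set A := laplaceMoment μ 0 s
      set B := laplaceMoment μ 1 s
      rw [show p * (B * sqLaplace μ s ^ (p - 1)) - c * (p * (A * sqLaplace μ s ^ (p - 1)))
        = (B - c * A) * (p * sqLaplace μ s ^ (p - 1)) by ring, norm_mul, Real.norm_eq_abs,
        Real.norm_of_nonneg (by positivity : 0 ≤ p * sqLaplace μ s ^ (p - 1))]
      rcases lt_or_ge s δ with hsδ | hsδ
      · have h1 := mul_le_mul_of_nonneg_right (hδ' s hs hsδ)
          (by positivity : 0 ≤ p * sqLaplace μ s ^ (p - 1))
        refine h1.trans ?_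
        rw [mul_assoc, mul_left_comm A]
        exact le_add_of_nonneg_right (by positivity)
      · have h1 : |B - c * A| ≤ B + A := by
          rw [abs_le]
          constructor <;> nlinarith
        have h2 : p * sqLaplace μ s ^ (p - 1) ≤ d * sqLaplace μ s := by
          rw [hpow, hd, ← mul_assoc]
          gcongr
          exact antitoneOn_sqLaplace hδ.le hs.le hsδ
        refine (mul_le_mul h1 h2 (by positivity) (by positivity)).trans ?_
        refine le_trans (le_of_eq ?_) (le_add_of_nonneg_left (by positivity))
        push_cast
        ring
    rw [e, ← Real.norm_eq_abs]
    refine (norm_integral_le_of_norm_le ((i0.const_mul ε).add ((j1.const_mul _).add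
      (j0.const_mul _))) ((ae_restrict_mem measurableSet_Ioi).mono hpt)).trans ?_
    have hB1 : ∫ s in Set.Ioi 0, ((2 : ℕ) : ℝ) * (laplaceMoment μ 1 s * sqLaplace μ s ^ (2 - 1))
        ≤ 1 := by
      rw [integral_laplaceMoment_mul h0 (by norm_num)]
      refine (integral_mono_of_nonneg (ae_of_all _ fun x => sum_pow_mul_div_nonneg 1 x)
        (integrable_const 1) (ae_of_all _ fun x => ?_)).trans (by simp)
      simpa using sum_pow_mul_div_le 1 x
    simp only [Pi.add_apply]
    rw [integral_add (i0.const_mul ε) ((j1.const_mul _).fun_add (j0.const_mul _)),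
      integral_add (j1.const_mul _) (j0.const_mul _), integral_const_mul ε, integral_const_mul (d / 2),
      integral_const_mul (d / 2), integral_laplaceMoment_zero_mul h0 (by omega),
      integral_laplaceMoment_zero_mul h0 (by norm_num)]
    linarith [mul_le_mul_of_nonneg_left hB1 (by positivity : 0 ≤ d / 2)]
  rw [Metric.tendsto_atTop]
  intro ε hε
  obtain ⟨δ, hδ, hb⟩ := hbound (ε / 2) (by positivity)
  set q := sqLaplace μ δ
  have hq0 : 0 ≤ q := sqLaplace_nonneg δ
  have hq1 : q < 1 := sqLaplace_lt_one h0 hδ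
  have hlim : Tendsto (fun p : ℕ => ((p + 2 : ℕ) : ℝ) * q ^ p) atTop (𝓝 0) := by
    have h1 := tendsto_self_mul_const_pow_of_lt_one hq0 hq1
    have h2 := (tendsto_pow_atTop_nhds_zero_of_lt_one hq0 hq1).const_mul 2
    have h3 := h1.add h2
    rw [mul_zero, add_zero] at h3
    refine h3.congr fun p => ?_
    push_cast
    ring
  obtain ⟨N, hN⟩ := eventually_atTop.1 (hlim.eventually (gt_mem_nhds (half_pos hε)))
  refine ⟨N + 2, fun p hp => ?_⟩
  have h1 := hN (p - 2) (by omega)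
  rw [show p - 2 + 2 = p by omega] at h1
  rw [Real.dist_eq]
  linarith [hb p (by omega)]

end SelfNormalized

/-! ### The Gaussian approximation at scale `t / √n`. -/

section Scaling

variable {E : Type*} [MeasurableSpace E] {ν : Measure E} [IsProbabilityMeasure ν]
  {h : E → E → ℝ}

omit [IsProbabilityMeasure ν] in
lemma DegenerateKernel.mono {a b a' b' : ℝ} (H : DegenerateKernel ν h a b) (ha : a ≤ a')
    (hb : b ≤ b') : DegenerateKernel ν h a' b' :=
  { H with
    integral_sq_le := fun x => (H.integral_sq_le x).trans ha
    integral_iterate_sq_le := H.integral_iterate_sq_le.trans hb }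

/-- The rates `1/n` and `1/n³` are those for which the accumulated Taylor and variance errors are
both of order `n^(-1/2)`. -/
lemma DegenerateKernel.norm_integral_cexp_scaled_sub_le {A B : ℝ} {n : ℕ} (hn : 0 < n)
    (H : DegenerateKernel ν h (A / n) (B / n ^ 3)) (hB : 0 ≤ B) (t : ℝ) :
    ‖∫ x, Complex.exp ((t / √n * pairSum h x : ℝ) * Complex.I) ∂(Measure.pi fun _ : Fin n => ν)
      - (Real.exp (-(t ^ 2 / 4 * ((n - 1) * ∫ z, ∫ x, h z x ^ 2 ∂ν ∂ν))) : ℝ)‖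
      ≤ (2 * |t| ^ 3 * (2 * A + 3 * A ^ 2) + t ^ 2 / 2 * √(2 * A ^ 2 + 8 * B)) * (√n)⁻¹
        + (t ^ 2 * A / 2) ^ 2 * (n : ℝ)⁻¹ := by
  have hn' : (0 : ℝ) < n := by exact_mod_cast hn
  have hw : 0 < √(n : ℝ) := Real.sqrt_pos.2 hn'
  have hw2 : √(n : ℝ) ^ 2 = n := Real.sq_sqrt hn'.le
  have key := H.norm_integral_cexp_pairSum_sub_le (by positivity) (t / √n) n
  set s := ∫ z, ∫ x, h z x ^ 2 ∂ν ∂ν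
  have e1 : (t / √n) ^ 2 / 2 * (n * (n - 1) / 2 * s) = t ^ 2 / 4 * ((n - 1) * s) := by
    rw [div_pow, hw2]
    field_simp
    ring
  rw [e1] at key
  refine key.trans (le_of_eq ?_)
  have e2 : 2 * n * (A / n) ^ 2 + 8 * (n : ℝ) ^ 2 * (B / n ^ 3)
      = (2 * A ^ 2 + 8 * B) * ((√n)⁻¹) ^ 2 := by
    rw [inv_pow, hw2]
    field_simp
  rw [e2, Real.sqrt_mul' _ (by positivity), Real.sqrt_sq (by positivity), abs_div,
    abs_of_pos hw, div_pow |t|, div_pow t, hw2,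
    show √(n : ℝ) ^ 3 = √n * n by rw [pow_succ, hw2, mul_comm]]
  field_simp

end Scaling

/-! ### The limit law of the Bingham statistic. -/

section Bingham

lemma sqrt_div_mul_binghamStat_eq {n p : ℕ} (hp : p ≠ 0) (hn : 0 < n)
    {x : Fin n → EuclideanSpace ℝ (Fin p)} (hx : ∀ i, ‖x i‖ = 1) :
    √n / p * binghamStat x = (√n)⁻¹ * pairSum binghamKernel x := by
  have hn' : (0 : ℝ) < n := by exact_mod_cast hn
  have hw2 : √(n : ℝ) ^ 2 = n := Real.sq_sqrt hn'.le
  have hw : √(n : ℝ) ≠ 0 := (Real.sqrt_pos.2 hn').ne'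
  have hp' : (p : ℝ) ≠ 0 := by exact_mod_cast hp
  have e : pairSum binghamKernel x
      = ∑ i : Fin n, ∑ j ∈ Finset.Ioi i, ((inner ℝ (x i) (x j)) ^ 2 - 1 / (p : ℝ)) :=
    Finset.sum_congr rfl fun i _ => Finset.sum_congr rfl fun j _ => by
      rw [binghamKernel_of_norm (hx i) (hx j), one_div]
  rw [binghamStat, e, ← mul_assoc]
  congr 1
  rw [← hw2]
  field_simp
  rw [Real.sqrt_sq (Real.sqrt_nonneg _)]

lemma aemeasurable_binghamStat {n p : ℕ} {Ω : Type*} [MeasurableSpace Ω] {P : Measure Ω}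
    {X : Fin n → Ω → EuclideanSpace ℝ (Fin p)} (hX : ∀ i, AEMeasurable (X i) P) :
    AEMeasurable (fun ω => binghamStat (fun i => X i ω)) P := by
  unfold binghamStat
  refine (Finset.aemeasurable_fun_sum _ fun i _ =>
    Finset.aemeasurable_fun_sum _ fun j _ => ?_).const_mul _
  exact (((hX i).inner (hX j)).pow_const 2).sub_const _

lemma IsSymmetricAlphaSpherical.norm_eq_one {α : ℝ} {μ : Measure ℝ} {p : ℕ}
    {ν : Measure (EuclideanSpace ℝ (Fin p))} (S : IsSymmetricAlphaSpherical α μ ν) :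
    ∀ᵐ x ∂ν, ‖x‖ = 1 :=
  S.supported.mono fun _ hx => mem_sphere_zero_iff_norm.1 hx

lemma IsSymmetricAlphaSpherical.isProbabilityMeasure_sphere {α : ℝ} {μ : Measure ℝ} {p : ℕ}
    {ν : Measure (EuclideanSpace ℝ (Fin p))} (S : IsSymmetricAlphaSpherical α μ ν) :
    IsProbabilityMeasure ν := by
  have := S.isProbabilityMeasure
  rw [S.eq_map]
  exact Measure.isProbabilityMeasure_map measurable_sphereProj.aemeasurable

/-- An atom of `μ` at `0` would give the zero vector positive mass; its projection is `0` by the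
convention for division, hence off the sphere. -/
lemma IsSymmetricAlphaSpherical.measure_singleton_zero {α : ℝ} {μ : Measure ℝ} {p : ℕ}
    {ν : Measure (EuclideanSpace ℝ (Fin p))} (S : IsSymmetricAlphaSpherical α μ ν) :
    μ {0} = 0 := by
  have := S.isProbabilityMeasure
  have h1 := S.norm_eq_one
  rw [S.eq_map] at h1
  have h2 := ae_of_ae_map measurable_sphereProj.aemeasurable h1
  have h3 : (Measure.pi fun _ : Fin p => μ) {fun _ => 0} = 0 := by
    refine measure_mono_null ?_ (ae_iff.1 h2)
    rintro x rfl
    have : sphereProj (fun _ : Fin p => (0 : ℝ)) = 0 := by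
      ext i
      simp
    simp [this]
  rw [Measure.pi_singleton, Finset.prod_const] at h3
  exact eq_zero_of_pow_eq_zero h3

lemma IsSymmetricAlphaSpherical.exists_hasSphericalMoments {α : ℝ} {μ : Measure ℝ} {p : ℕ}
    {ν : Measure (EuclideanSpace ℝ (Fin p))} (S : IsSymmetricAlphaSpherical α μ ν) (hp : 2 ≤ p) :
    ∃ m₂₂, HasSphericalMoments ν ((p : ℝ)⁻¹ *
      ∫ x : Fin p → ℝ, ∑ k, sphereProj x k ^ 4 ∂(Measure.pi fun _ => μ)) m₂₂ := by
  have := S.isProbabilityMeasure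
  have := S.isProbabilityMeasure_sphere
  have h := hasSphericalMoments_map_sphereProj μ S.symmetric hp S.eq_map S.norm_eq_one
  have e : ∫ z, ∑ k, z k ^ 4 ∂ν
      = ∫ x : Fin p → ℝ, ∑ k, sphereProj x k ^ 4 ∂(Measure.pi fun _ => μ) := by
    rw [S.eq_map, integral_map measurable_sphereProj.aemeasurable
      (Measurable.aestronglyMeasurable (by fun_prop))]
  rwa [e] at h

/-- Since `p m₂₂ = O(1/p)`, only the square of `p m₄` survives in `p s`, and `n / p → γ⁻¹`. -/
lemma tendsto_natCast_mul_integral_binghamKernel_sq {α γ : ℝ} (hα0 : 0 < α) (hα2 : α < 2)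
    (hγ : 0 < γ) {p : ℕ → ℕ} (hp : Tendsto (fun n : ℕ => (p n : ℝ) / (n : ℝ)) atTop (𝓝 γ))
    {μ : Measure ℝ} {ν : (n : ℕ) → Measure (EuclideanSpace ℝ (Fin (p n)))}
    (hν : ∀ᶠ n in atTop, IsSymmetricAlphaSpherical α μ (ν n)) :
    Tendsto (fun n : ℕ => n * ∫ z, ∫ x, binghamKernel z x ^ 2 ∂(ν n) ∂(ν n)) atTop
      (𝓝 (γ⁻¹ * (1 - α / 2) ^ 2)) := by
  obtain ⟨n₀, S₀⟩ := hν.exists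
  have := S₀.isProbabilityMeasure
  have hp_top : Tendsto p atTop atTop := by
    have h1 : Tendsto (fun n : ℕ => (p n : ℝ)) atTop atTop := by
      refine (hp.pos_mul_atTop hγ tendsto_natCast_atTop_atTop).congr' ?_
      filter_upwards [eventually_gt_atTop 0] with n hn
      have : (n : ℝ) ≠ 0 := by positivity
      field_simp
    exact tendsto_natCast_atTop_iff.1 h1
  have hc := (S₀.regularlyVarying.tendsto_integral_sum_sphereProj_pow_four hα0 hα2
    S₀.measure_singleton_zero).comp hp_top
  set c : ℕ → ℝ := fun n => ∫ x : Fin (p n) → ℝ, ∑ k, sphereProj x k ^ 4 ∂(Measure.pi fun _ => μ)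
    with hcdef
  have hr : Tendsto (fun n => ((p n : ℝ))⁻¹) atTop (𝓝 0) :=
    tendsto_inv_atTop_zero.comp (tendsto_natCast_atTop_atTop.comp hp_top)
  -- The moments exist only for large `n`; the default `0` elsewhere makes `m` a sequence without
  -- affecting limits.
  have hex : ∀ n, ∃ m : ℝ, IsSymmetricAlphaSpherical α μ (ν n) → 2 ≤ p n →
      HasSphericalMoments (ν n) ((p n : ℝ)⁻¹ * c n) m := fun n => by
    by_cases hS : IsSymmetricAlphaSpherical α μ (ν n) ∧ 2 ≤ p n
    · obtain ⟨m, hm⟩ := hS.1.exists_hasSphericalMoments hS.2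
      exact ⟨m, fun _ _ => hm⟩
    · exact ⟨0, fun h1 h2 => absurd ⟨h1, h2⟩ hS⟩
  choose m hm using hex
  have hpm : Tendsto (fun n => p n * m n) atTop (𝓝 0) := by
    have hr2 := hr.const_mul 2
    rw [mul_zero] at hr2
    refine tendsto_of_tendsto_of_tendsto_of_le_of_le' tendsto_const_nhds hr2 ?_ ?_
    · filter_upwards [hν, hp_top.eventually_ge_atTop 2] with n S h2
      exact mul_nonneg (Nat.cast_nonneg _) (hm n S h2).mixed_nonneg
    · filter_upwards [hν, hp_top.eventually_ge_atTop 2] with n S h2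
      have hp0 : (p n : ℝ) ≠ 0 := by positivity
      calc (p n : ℝ) * m n ≤ p n * (2 * ((p n : ℝ)⁻¹) ^ 2) := by
            gcongr
            exact (hm n S h2).mixed_le h2
        _ = 2 * ((p n : ℝ))⁻¹ := by field_simp
  have hlim : Tendsto (fun n => ((p n : ℝ) / n)⁻¹ *
      ((c n - 3 * (p n * m n)) * c n + 3 * (p n * m n) - (p n : ℝ)⁻¹)) atTop
      (𝓝 (γ⁻¹ * (((1 - α / 2) - 3 * 0) * (1 - α / 2) + 3 * 0 - 0))) :=
    (hp.inv₀ hγ.ne').mul ((((hc.sub (hpm.const_mul 3)).mul hc).add (hpm.const_mul 3)).sub hr)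
  rw [show ((1 - α / 2) - 3 * 0) * (1 - α / 2) + 3 * 0 - 0 = (1 - α / 2) ^ 2 by ring] at hlim
  refine hlim.congr' ?_
  filter_upwards [hν, hp_top.eventually_ge_atTop 2, eventually_gt_atTop 0] with n S h2 hn
  have := S.isProbabilityMeasure_sphere
  have hp0 : (p n : ℝ) ≠ 0 := by positivity
  have hn0 : (n : ℝ) ≠ 0 := by positivity
  rw [(hm n S h2).integral_integral_binghamKernel_sq]
  field_simp

/-- The central limit theorem for the Bingham statistic, with a vanishing deterministic shift. -/
lemma tendstoInDistribution_binghamStat_sub {α γ : ℝ} (hα0 : 0 < α) (hα2 : α < 2) (hγ : 0 < γ)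
    (p : ℕ → ℕ) (hp : Tendsto (fun n : ℕ => (p n : ℝ) / (n : ℝ)) atTop (𝓝 γ))
    (μ : Measure ℝ) (ν : (n : ℕ) → Measure (EuclideanSpace ℝ (Fin (p n))))
    (hν : ∀ᶠ n in atTop, IsSymmetricAlphaSpherical α μ (ν n))
    (Ω : ℕ → Type*) [∀ n, MeasurableSpace (Ω n)]
    (P : (n : ℕ) → Measure (Ω n)) [∀ n, IsProbabilityMeasure (P n)]
    (X : (n : ℕ) → Fin n → Ω n → EuclideanSpace ℝ (Fin (p n)))
    (hlaw : ∀ n i, HasLaw (X n i) (ν n) (P n))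
    (hindep : ∀ n, iIndepFun (X n) (P n)) (c : ℕ → ℝ) (hc : Tendsto c atTop (𝓝 0)) :
    TendstoInDistribution
        (fun (n : ℕ) (ω : Ω n) => √(n : ℝ) / (p n : ℝ) * binghamStat (fun i => X n i ω) - c n)
        atTop (id : ℝ → ℝ) P (gaussianReal 0 (Real.toNNReal ((2 - α) ^ 2 / (8 * γ)))) where
  forall_aemeasurable n :=
    ((aemeasurable_binghamStat fun i => (hlaw n i).aemeasurable).const_mul _).sub_const _
  tendsto := by
    refine ProbabilityMeasure.tendsto_iff_tendsto_charFun.2 fun t => ?_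
    have haem : ∀ n, AEMeasurable (fun ω : Ω n => √(n : ℝ) / (p n : ℝ) *
        binghamStat (fun i => X n i ω) - c n) (P n) := fun n =>
      ((aemeasurable_binghamStat fun i => (hlaw n i).aemeasurable).const_mul _).sub_const _
    have hv : 0 ≤ (2 - α) ^ 2 / (8 * γ) := by positivity
    have htarget : charFun ((gaussianReal 0 (Real.toNNReal ((2 - α) ^ 2 / (8 * γ)))).map id) t
        = Complex.exp (-(t * (0 : ℝ) : ℝ) * Complex.I) *
          (Real.exp (-(t ^ 2 / 4 * (γ⁻¹ * (1 - α / 2) ^ 2))) : ℝ) := by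
      rw [Measure.map_id, charFun_gaussianReal, Real.coe_toNNReal _ hv, Complex.ofReal_exp]
      simp only [mul_zero, Complex.ofReal_zero, neg_zero, zero_mul, Complex.exp_zero, one_mul,
        zero_sub]
      congr 1
      push_cast
      have : (γ : ℂ) ≠ 0 := by exact_mod_cast hγ.ne'
      field_simp
      ring
    set s : ℕ → ℝ := fun n => ∫ z, ∫ x, binghamKernel z x ^ 2 ∂(ν n) ∂(ν n) with hs
    have hns := tendsto_natCast_mul_integral_binghamKernel_sq hα0 hα2 hγ hp hν
    have hinv : Tendsto (fun n : ℕ => ((n : ℝ))⁻¹) atTop (𝓝 0) := tendsto_inv_atTop_nhds_zero_nat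
    have hn1s : Tendsto (fun n : ℕ => ((n : ℝ) - 1) * s n) atTop (𝓝 (γ⁻¹ * (1 - α / 2) ^ 2)) := by
      have h1 := hns.sub (hinv.mul hns)
      rw [zero_mul, sub_zero] at h1
      refine h1.congr' ?_
      filter_upwards [eventually_gt_atTop 0] with n hn
      have : (n : ℝ) ≠ 0 := by positivity
      simp only [hs]
      field_simp
    -- Eventually `p / n > γ / 2`, so `1/p ≤ 2 γ⁻¹ / n`; this turns the kernel bounds `4/p` and
    -- `108/p³` into `A/n` and `B/n³`.
    set A := 4 * (2 * γ⁻¹) with hA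
    set B := 108 * (2 * γ⁻¹) ^ 3 with hB
    set J : ℕ → ℂ := fun n => ∫ x, Complex.exp ((t / √n * pairSum binghamKernel x : ℝ) * Complex.I)
      ∂(Measure.pi fun _ : Fin n => ν n) with hJ
    have hgood : ∀ᶠ n in atTop, 0 < n ∧ 2 ≤ p n ∧ IsSymmetricAlphaSpherical α μ (ν n) ∧
        ((p n : ℝ))⁻¹ ≤ 2 * γ⁻¹ / n := by
      have h1 : ∀ᶠ n in atTop, γ / 2 < (p n : ℝ) / n := hp.eventually (lt_mem_nhds (by linarith))
      have h2 : Tendsto (fun n : ℕ => γ / 2 * (n : ℝ)) atTop atTop :=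
        tendsto_natCast_atTop_atTop.const_mul_atTop (by linarith)
      filter_upwards [hν, h1, h2.eventually_ge_atTop 2, eventually_gt_atTop 0] with n S h1 h2 hn
      have hn' : (0 : ℝ) < n := by exact_mod_cast hn
      rw [lt_div_iff₀ hn'] at h1
      refine ⟨hn, by exact_mod_cast (h2.trans h1.le), S, ?_⟩
      rw [show 2 * γ⁻¹ / n = (γ / 2 * n)⁻¹ by field_simp]
      exact inv_anti₀ (by positivity) h1.le
    have hJlim : Tendsto J atTop
        (𝓝 ((Real.exp (-(t ^ 2 / 4 * (γ⁻¹ * (1 - α / 2) ^ 2))) : ℝ) : ℂ)) := by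
      have h1 : Tendsto (fun n : ℕ => ((Real.exp (-(t ^ 2 / 4 * ((n - 1) * s n))) : ℝ) : ℂ)) atTop
          (𝓝 ((Real.exp (-(t ^ 2 / 4 * (γ⁻¹ * (1 - α / 2) ^ 2))) : ℝ) : ℂ)) :=
        (Complex.continuous_ofReal.tendsto _).comp
          ((Real.continuous_exp.tendsto _).comp (hn1s.const_mul _).neg)
      have hsq : Tendsto (fun n : ℕ => (√(n : ℝ))⁻¹) atTop (𝓝 0) :=
        tendsto_inv_atTop_zero.comp (Real.tendsto_sqrt_atTop.comp tendsto_natCast_atTop_atTop)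
      have h2 := (hsq.const_mul (2 * |t| ^ 3 * (2 * A + 3 * A ^ 2)
        + t ^ 2 / 2 * √(2 * A ^ 2 + 8 * B))).add (hinv.const_mul ((t ^ 2 * A / 2) ^ 2))
      rw [mul_zero, mul_zero, add_zero] at h2
      have h3 : Tendsto (fun n : ℕ => J n - ((Real.exp (-(t ^ 2 / 4 * ((n - 1) * s n))) : ℝ) : ℂ))
          atTop (𝓝 0) := by
        refine squeeze_zero_norm' ?_ h2
        filter_upwards [hgood] with n hgn
        obtain ⟨hn, h2p, S, hpn⟩ := hgn
        have := S.isProbabilityMeasure_sphere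
        obtain ⟨m, hm⟩ := S.exists_hasSphericalMoments h2p
        have hn' : (0 : ℝ) < n := by exact_mod_cast hn
        have H := (hm.degenerateKernel_binghamKernel h2p).mono (a' := A / n) (b' := B / n ^ 3)
          (by rw [hA, mul_div_assoc]; gcongr)
          (by rw [hB, mul_div_assoc, ← div_pow]; gcongr)
        exact H.norm_integral_cexp_scaled_sub_le hn (by positivity) t
      simpa using h3.add h1
    have hshift : Tendsto (fun n => Complex.exp (-(t * c n : ℝ) * Complex.I)) atTop
        (𝓝 (Complex.exp (-(t * (0 : ℝ) : ℝ) * Complex.I))) := by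
      have h1 : Continuous fun y : ℝ => Complex.exp (-(t * y : ℝ) * Complex.I) := by fun_prop
      exact (h1.tendsto 0).comp hc
    simp only [ProbabilityMeasure.coe_mk]
    rw [htarget]
    refine (hshift.mul hJlim).congr' ?_
    filter_upwards [hgood] with n hgn
    obtain ⟨hn, h2p, S, -⟩ := hgn
    have := S.isProbabilityMeasure_sphere
    have hmap : (P n).map (fun ω i => X n i ω) = Measure.pi fun _ : Fin n => ν n := by
      rw [(iIndepFun_iff_map_fun_eq_pi_map fun i => (hlaw n i).aemeasurable).1 (hindep n)]
      simp_rw [(hlaw n _).map_eq]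
    have hnorm : ∀ᵐ ω ∂(P n), ∀ i, ‖X n i ω‖ = 1 := by
      refine ae_all_iff.2 fun i => ?_
      have := S.norm_eq_one
      rw [← (hlaw n i).map_eq] at this
      exact ae_of_ae_map (hlaw n i).aemeasurable this
    rw [charFun_apply_real, integral_map (haem n) (by fun_prop), hJ]
    simp only
    rw [← hmap, integral_map (aemeasurable_pi_lambda _ fun i => (hlaw n i).aemeasurable),
      ← integral_const_mul]
    · refine integral_congr_ae ?_
      filter_upwards [hnorm] with ω hω
      rw [sqrt_div_mul_binghamStat_eq (by omega) hn hω, ← Complex.exp_add]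
      congr 1
      push_cast
      ring
    · have hK : BoundedMeasurable (Function.uncurry (binghamKernel (p := p n))) :=
        ⟨measurable_binghamKernel, 1, fun q => abs_binghamKernel_le_one q.1 q.2⟩
      have := (hK.pairSum n).1
      exact Measurable.aestronglyMeasurable (by fun_prop)

lemma gaussianReal_zero_Ici {v : NNReal} (hv : v ≠ 0) :
    gaussianReal 0 v (Set.Ici 0) = 1 / 2 := by
  have := nullSingletonClass_gaussianReal (μ := 0) hv
  have h1 : gaussianReal 0 v (Set.Iio 0) = gaussianReal 0 v (Set.Ici 0) := by
    conv_lhs => rw [← neg_zero, ← gaussianReal_map_neg]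
    rw [Measure.map_apply measurable_neg measurableSet_Iio]
    simp [measure_congr Ioi_ae_eq_Ici]
  have h2 := prob_add_prob_compl (μ := gaussianReal 0 v) (s := Set.Ici 0) measurableSet_Ici
  rw [Set.compl_Ici, h1, ← two_mul] at h2
  rw [ENNReal.eq_div_iff (by norm_num) (by norm_num), h2]

end Bingham

theorem theorem2 (α γ : ℝ) (hα0 : 0 < α) (hα2 : α < 2) (hγ : 0 < γ)
    (p : ℕ → ℕ) (hp : Tendsto (fun n : ℕ => (p n : ℝ) / (n : ℝ)) atTop (𝓝 γ))
    -- the law on the line is the same for all `n`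
    (μ : Measure ℝ) (ν : (n : ℕ) → Measure (EuclideanSpace ℝ (Fin (p n))))
    (hν : ∀ᶠ n in atTop, IsSymmetricAlphaSpherical α μ (ν n))
    -- for each `n`, a sample of `n` independent points with law `ν n`
    (Ω : ℕ → Type*) [∀ n, MeasurableSpace (Ω n)]
    (P : (n : ℕ) → Measure (Ω n)) [∀ n, IsProbabilityMeasure (P n)]
    (X : (n : ℕ) → Fin n → Ω n → EuclideanSpace ℝ (Fin (p n)))
    (hlaw : ∀ n i, HasLaw (X n i) (ν n) (P n))
    (hindep : ∀ n, iIndepFun (X n) (P n)) :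
    TendstoInDistribution
        (fun (n : ℕ) (ω : Ω n) => √(n : ℝ) / (p n : ℝ) * binghamStat (fun i => X n i ω))
        atTop (id : ℝ → ℝ) P (gaussianReal 0 (Real.toNNReal ((2 - α) ^ 2 / (8 * γ)))) ∧
      ∀ β : ℝ, 0 < β → β < 1 → ∀ q : ℝ, cdf (gaussianReal 0 1) q = 1 - β →
        Tendsto (fun n : ℕ => (P n).real {ω | q ≤ binghamStat (fun i => X n i ω)})
          atTop (𝓝 (1 / 2)) := by

  have hclt := tendstoInDistribution_binghamStat_sub hα0 hα2 hγ p hp μ ν hν Ω P X hlaw hindep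
  refine ⟨by simpa using hclt (fun _ => 0) tendsto_const_nhds, fun β _ _ q _ => ?_⟩
  have hinv : Tendsto (fun n : ℕ => (√(n : ℝ))⁻¹) atTop (𝓝 0) :=
    tendsto_inv_atTop_zero.comp (Real.tendsto_sqrt_atTop.comp tendsto_natCast_atTop_atTop)
  -- `√n / p = (n / p) / √n` tends to `0`, so the rescaled critical value is an admissible shift `c
  -- n`.
  have hc : Tendsto (fun n : ℕ => √(n : ℝ) / p n * q) atTop (𝓝 0) := by
    have h1 := ((hp.inv₀ hγ.ne').mul hinv).mul_const q
    rw [mul_zero, zero_mul] at h1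
    refine h1.congr' ?_
    filter_upwards [eventually_gt_atTop 0] with n hn
    have hn' : (0 : ℝ) < n := by exact_mod_cast hn
    have hw : 0 < √(n : ℝ) := Real.sqrt_pos.2 hn'
    rw [inv_div, div_mul_eq_mul_div]
    congr 2
    rw [← div_eq_mul_inv, Real.div_sqrt]
  have hv : Real.toNNReal ((2 - α) ^ 2 / (8 * γ)) ≠ 0 := by
    rw [Ne, Real.toNNReal_eq_zero, not_le]
    have : 0 < 2 - α := by linarith
    positivity
  have := nullSingletonClass_gaussianReal (μ := 0) hv
  have hfin := (hclt _ hc)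
  -- Portmanteau for `[0, ∞)`: its frontier `{0}` is null because the limit variance is positive.
  have hlim := ProbabilityMeasure.tendsto_measure_of_null_frontier_of_tendsto' hfin.tendsto
    (E := Set.Ici 0) (by simp)
  simp only [ProbabilityMeasure.coe_mk, Measure.map_id, gaussianReal_zero_Ici hv] at hlim
  have hreal := (ENNReal.tendsto_toReal (by simp)).comp hlim
  have e : (1 / 2 : ENNReal).toReal = 1 / 2 := by simp
  rw [e] at hreal
  refine hreal.congr' ?_
  have hp_pos : ∀ᶠ n in atTop, 0 < (p n : ℝ) / n := hp.eventually (lt_mem_nhds hγ)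
  filter_upwards [eventually_gt_atTop 0, hp_pos] with n hn hpn
  have hn' : (0 : ℝ) < n := by exact_mod_cast hn
  have hw : 0 < √(n : ℝ) := Real.sqrt_pos.2 hn'
  have hp' : (0 : ℝ) < p n := by
    rw [div_pos_iff_of_pos_right hn'] at hpn
    exact hpn
  rw [Function.comp_apply, Measure.map_apply_of_aemeasurable (hfin.forall_aemeasurable n)
    measurableSet_Ici]
  unfold Measure.real
  congr 2
  ext ω
  have : 0 < √(n : ℝ) / p n := by positivity
  simp only [Set.mem_preimage, Set.mem_Ici, sub_nonneg, Set.mem_ofPred_eq]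
  exact mul_le_mul_iff_right₀ this
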